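/- Let $k$ be a field with $\operatorname{char}(k)\neq 2$ and let $A=k\langle X,Y\rangle/(X^2,\,XY+YX,\,Y^2)$, with $x,y$ the classes of $X,Y$. Let $A^e=A\otimes_k A^{\mathrm{op}}$ and let $HH^{2*}(A)=\bigoplus_{t\ge 0}\operatorname{Ext}^{2t}_{A^e}(A,A)$ be the even part of the Hochschild cohomology of $A$, a graded $k$-algebra under the Yoneda product. Consider the free resolution of the $A^e$-module $A$ with terms $P_n=\bigoplus_{i=0}^n A^e f^n_i$, augmentation $P_0\to A$, $f^0_0\mapsto 1$, and differentials $$d_n(f^n_i)=\begin{cases}(-1)^i\big((1\otimes y+y\otimes 1)f^{n-1}_i+(1\otimes x+x\otimes 1)f^{n-1}_{i-1}\big)& n\text{ even},\\(-1)^i\big((1\otimes y-y\otimes 1)f^{n-1}_i-(1\otimes x-x\otimes 1)f^{n-1}_{i-1}\big)& n\text{ odd},\end{cases}$$ where $f^{n}_{-1}=f^{n}_{n+1}=0$. For $t\ge 0$ and $0\le r\le 2t$ let $\xi^{2t}_r\in HH^{2t}(A)$ be the class of the cocycle $P_{2t}\to A$, $f^{2t}_i\mapsto\delta_{ir}\cdot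 1_A$, and let $R$ be the $k$-subalgebra of $HH^{2*}(A)$ generated by all the $\xi^{2t}_r$. Then $HH^{2*}(A)$ has a largest homogeneous nilpotent ideal $\mathcal N$, and the inclusion $R\subseteq HH^{2*}(A)$ induces an isomorphism of $k$-algebras $R\cong HH^{2*}(A)/\mathcal N$. -/

import Mathlib

open CategoryTheory CategoryTheory.Abelian
open scoped TensorProduct DirectSum

universe u

namespace Hochschild

section

/-- The enveloping algebra `A ⊗ Aᵒᵖ` of a `k`-algebra `A`. -/
abbrev EnvelopingAlgebra (k A : Type u) [Field k] [Ring A] [Algebra k A] : Type u :=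
  A ⊗[k] Aᵐᵒᵖ

/-- `A` is a left module over its enveloping algebra by `(a ⊗ b) • c = a * c * b`. -/
noncomputable instance (k A : Type u) [Field k] [Ring A] [Algebra k A] :
    Module (EnvelopingAlgebra k A) A :=
  TensorProduct.Algebra.module

theorem tmul_smul_eq {k A : Type u} [Field k] [Ring A] [Algebra k A] (a : A) (b : Aᵐᵒᵖ) (c : A) :
    (a ⊗ₜ[k] b : EnvelopingAlgebra k A) • c = a * (c * b.unop) := rfl

/-- `A` as an object of the category of left modules over the enveloping algebra. -/
noncomputable abbrev bimodule (k A : Type u) [Field k] [Ring A] [Algebra k A] :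
    ModuleCat.{u} (EnvelopingAlgebra k A) :=
  ModuleCat.of (EnvelopingAlgebra k A) A

/-- Hochschild cohomology `HHⁿ(A) = Extⁿ(A, A)` over the enveloping algebra. -/
abbrev HH (k A : Type u) [Field k] [Ring A] [Algebra k A] (n : ℕ) : Type u :=
  Ext.{u} (bimodule k A) (bimodule k A) n

/-- The even part, indexed so that index `t` carries cohomological degree `2 * t`. -/
abbrev HHEven (k A : Type u) [Field k] [Ring A] [Algebra k A] (t : ℕ) : Type u :=
  HH k A (2 * t)

variable {k A : Type u} [Field k] [Ring A] [Algebra k A]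

theorem one_comp_aux {s t : ℕ} (hst : s = t) (β : HH k A (2 * t)) (h : 0 + 2 * t = 2 * s) :
    GradedMonoid.mk (A := HHEven k A) s ((Ext.mk₀ (𝟙 (bimodule k A))).comp β h) =
      GradedMonoid.mk t β := by
  subst hst
  rw [Ext.mk₀_id_comp]

theorem comp_one_aux {s t : ℕ} (hst : s = t) (β : HH k A (2 * t)) (h : 2 * t + 0 = 2 * s) :
    GradedMonoid.mk (A := HHEven k A) s (β.comp (Ext.mk₀ (𝟙 (bimodule k A))) h) =
      GradedMonoid.mk t β := by
  subst hst
  rw [Ext.comp_mk₀_id]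

theorem comp_assoc_aux {a b c s t : ℕ} (α : HH k A (2 * a)) (β : HH k A (2 * b))
    (γ : HH k A (2 * c)) (hst : s = t) (h₁ : 2 * a + 2 * b = 2 * (a + b))
    (h₂ : 2 * (a + b) + 2 * c = 2 * s) (h₃ : 2 * b + 2 * c = 2 * (b + c))
    (h₄ : 2 * a + 2 * (b + c) = 2 * t) :
    GradedMonoid.mk (A := HHEven k A) s ((α.comp β h₁).comp γ h₂) =
      GradedMonoid.mk (A := HHEven k A) t (α.comp (β.comp γ h₃) h₄) := by
  subst hst
  rw [Ext.comp_assoc α β γ h₁ h₃ (by lia)]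

noncomputable instance : GradedMonoid.GOne (HHEven k A) where
  one := Ext.mk₀ (𝟙 (bimodule k A))

/-- The Yoneda product: `α * β` is the composite of `α : A → A[2i]` with `β : A → A[2j]`. -/
noncomputable instance : GradedMonoid.GMul (HHEven k A) where
  mul {i j} α β := Ext.comp α β (Nat.mul_add 2 i j).symm

noncomputable instance : GradedMonoid.GMonoid (HHEven k A) where
  one_mul := fun ⟨i, a⟩ => one_comp_aux (zero_add i) a (by lia)
  mul_one := fun ⟨i, a⟩ => comp_one_aux (add_zero i) a (by lia)
  mul_assoc := fun ⟨i, a⟩ ⟨j, b⟩ ⟨l, c⟩ =>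
    comp_assoc_aux a b c (add_assoc i j l) (by lia) (by lia) (by lia) (by lia)

noncomputable instance : DirectSum.GRing (HHEven k A) where
  mul_zero {i j} a := Ext.comp_zero a _ (2 * j) (2 * (i + j)) (Nat.mul_add 2 i j).symm
  zero_mul {i j} b := Ext.zero_comp _ (2 * i) b (2 * (i + j)) (Nat.mul_add 2 i j).symm
  mul_add {i j} a b c := Ext.comp_add a b c (Nat.mul_add 2 i j).symm
  add_mul {i j} a b c := Ext.add_comp a b c (Nat.mul_add 2 i j).symm
  natCast n := n • (GradedMonoid.GOne.one : HHEven k A 0)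
  natCast_zero := zero_smul _ _
  natCast_succ n := succ_nsmul _ n
  intCast n := n • (GradedMonoid.GOne.one : HHEven k A 0)
  intCast_ofNat _ := natCast_zsmul _ _
  intCast_negSucc_ofNat _ := negSucc_zsmul _ _

theorem smul_comp_aux {s t : ℕ} (hst : s = t) (c : k) (β : HH k A (2 * t))
    (h : 0 + 2 * t = 2 * s) :
    GradedMonoid.mk (A := HHEven k A) s ((c • Ext.mk₀ (𝟙 (bimodule k A))).comp β h) =
      GradedMonoid.mk t (c • β) := by
  subst hst
  rw [Ext.smul_comp, Ext.mk₀_id_comp]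

theorem comp_smul_aux {s t : ℕ} (hst : s = t) (c : k) (β : HH k A (2 * t))
    (h : 2 * t + 0 = 2 * s) :
    GradedMonoid.mk (A := HHEven k A) s (β.comp (c • Ext.mk₀ (𝟙 (bimodule k A))) h) =
      GradedMonoid.mk t (c • β) := by
  subst hst
  rw [Ext.comp_smul, Ext.comp_mk₀_id]

noncomputable instance : DirectSum.GAlgebra k (HHEven k A) where
  toFun :=
    { toFun := fun c => c • (GradedMonoid.GOne.one : HHEven k A 0)
      map_zero' := zero_smul _ _
      map_add' := fun _ _ => add_smul _ _ _ }
  map_one := one_smul k (GradedMonoid.GOne.one : HHEven k A 0)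
  map_mul r s :=
    (congrArg (GradedMonoid.mk 0) (mul_smul r s _)).trans
      (smul_comp_aux (zero_add 0) r (s • (GradedMonoid.GOne.one : HHEven k A 0)) (by lia)).symm
  commutes r := fun ⟨i, x⟩ =>
    (smul_comp_aux (zero_add i) r x (by lia)).trans
      (comp_smul_aux (add_zero i) r x (by lia)).symm
  smul_def r := fun ⟨i, x⟩ => (smul_comp_aux (zero_add i) r x (by lia)).symm

/-- The even Hochschild cohomology ring `⨁ₜ HH²ᵗ(A)` with the Yoneda product; the instances above
make it a `k`-algebra. -/
abbrev HHEvenRing (k A : Type u) [Field k] [Ring A] [Algebra k A] : Type u :=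
  ⨁ t, HHEven k A t

/-- A two-sided ideal is homogeneous if it contains all homogeneous components of its elements. -/
def IsHomogeneous (I : TwoSidedIdeal (HHEvenRing k A)) : Prop :=
  ∀ z ∈ I, ∀ t : ℕ, DirectSum.of (HHEven k A) t (z t) ∈ I

variable (k A) in
/-- The homogeneous nilpotent ideals (`I ^ m = 0` for some `m`) of the even Hochschild cohomology
ring. -/
def homogeneousNilpotentIdeals : Set (TwoSidedIdeal (HHEvenRing k A)) :=
  {I | IsHomogeneous I ∧ IsNilpotent I.asIdeal}

end

end Hochschild

namespace QCI

section

open Hochschild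

/-- The relations `X² = 0`, `XY + YX = 0`, `Y² = 0`, where `X`, `Y` are the free generators `0`, `1`. -/
inductive Rel (k : Type u) [Field k] : FreeAlgebra k (Fin 2) → FreeAlgebra k (Fin 2) → Prop
  | xx : Rel k (FreeAlgebra.ι k 0 ^ 2) 0
  | xy : Rel k (FreeAlgebra.ι k 0 * FreeAlgebra.ι k 1 + FreeAlgebra.ι k 1 * FreeAlgebra.ι k 0) 0
  | yy : Rel k (FreeAlgebra.ι k 1 ^ 2) 0

/-- The algebra `k⟨X, Y⟩ / (X², XY + YX, Y²)`. -/
def Alg (k : Type u) [Field k] : Type u := RingQuot (Rel k)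

noncomputable instance (k : Type u) [Field k] : Ring (Alg k) :=
  inferInstanceAs (Ring (RingQuot (Rel k)))

noncomputable instance (k : Type u) [Field k] : Algebra k (Alg k) :=
  inferInstanceAs (Algebra k (RingQuot (Rel k)))

/-- The quotient map from the free algebra. -/
noncomputable def mk (k : Type u) [Field k] : FreeAlgebra k (Fin 2) →ₐ[k] Alg k :=
  RingQuot.mkAlgHom k (Rel k)

theorem mk_surjective (k : Type u) [Field k] : Function.Surjective (mk k) :=
  RingQuot.mkAlgHom_surjective k (Rel k)

theorem mk_rel {k : Type u} [Field k] {a b : FreeAlgebra k (Fin 2)} (h : Rel k a b) :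
    mk k a = mk k b :=
  RingQuot.mkAlgHom_rel k h

variable (k : Type u) [Field k]

/-- The class of `X`. -/
noncomputable def x : Alg k := mk k (FreeAlgebra.ι k 0)
/-- The class of `Y`. -/
noncomputable def y : Alg k := mk k (FreeAlgebra.ι k 1)

theorem x_mul_x : x k * x k = 0 := by
  have h := mk_rel (Rel.xx (k := k))
  simpa [x, sq] using h

theorem y_mul_y : y k * y k = 0 := by
  have h := mk_rel (Rel.yy (k := k))
  simpa [y, sq] using h

theorem y_mul_x : y k * x k = -(x k * y k) := by
  have h := mk_rel (Rel.xy (k := k))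
  simp only [map_add, map_mul, map_zero] at h
  exact eq_neg_of_add_eq_zero_right h

/-- The universal property of `Alg k`. -/
noncomputable def lift {B : Type u} [Ring B] [Algebra k B] (a b : B) (haa : a * a = 0)
    (hab : a * b + b * a = 0) (hbb : b * b = 0) : Alg k →ₐ[k] B :=
  RingQuot.liftAlgHom k ⟨FreeAlgebra.lift k ![a, b], by
    rintro _ _ (_ | _ | _) <;> simp [sq, haa, hab, hbb]⟩

variable {k} in
theorem lift_x {B : Type u} [Ring B] [Algebra k B] {a b : B} {haa : a * a = 0}
    {hab : a * b + b * a = 0} {hbb : b * b = 0} : lift k a b haa hab hbb (x k) = a := by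
  exact (RingQuot.liftAlgHom_mkAlgHom_apply k _ _ _).trans (by simp)

variable {k} in
theorem lift_y {B : Type u} [Ring B] [Algebra k B] {a b : B} {haa : a * a = 0}
    {hab : a * b + b * a = 0} {hbb : b * b = 0} : lift k a b haa hab hbb (y k) = b := by
  exact (RingQuot.liftAlgHom_mkAlgHom_apply k _ _ _).trans (by simp)

variable {k} in
theorem alg_induction {p : Alg k → Prop} (one : p 1) (add : ∀ a b, p a → p b → p (a + b))
    (smul : ∀ (c : k) a, p a → p (c • a)) (mul_x : ∀ a, p a → p (a * x k))
    (mul_y : ∀ a, p a → p (a * y k)) (a : Alg k) : p a := by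
  obtain ⟨w, rfl⟩ := mk_surjective k a
  have key : ∀ b : Alg k, p b → p (b * mk k w) := by
    induction w using FreeAlgebra.induction with
    | grade0 r =>
      intro b hb
      rw [AlgHom.commutes, ← Algebra.commutes, ← Algebra.smul_def]
      exact smul r b hb
    | grade1 i =>
      intro b hb
      fin_cases i
      · exact mul_x b hb
      · exact mul_y b hb
    | mul v w hv hw =>
      intro b hb
      rw [map_mul, ← mul_assoc]
      exact hw _ (hv b hb)
    | add v w hv hw =>
      intro b hb
      rw [map_add, mul_add]
      exact add _ _ (hv b hb) (hw b hb)
  simpa using key 1 one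

/-- The enveloping algebra of `Alg k`. -/
abbrev Ae : Type u := EnvelopingAlgebra k (Alg k)

/-- `x ⊗ 1` -/
noncomputable def xl : Ae k := x k ⊗ₜ 1
/-- `1 ⊗ x` -/
noncomputable def xr : Ae k := 1 ⊗ₜ MulOpposite.op (x k)
/-- `y ⊗ 1` -/
noncomputable def yl : Ae k := y k ⊗ₜ 1
/-- `1 ⊗ y` -/
noncomputable def yr : Ae k := 1 ⊗ₜ MulOpposite.op (y k)

noncomputable def betaX : Ae k := xr k + xl k
noncomputable def betaY : Ae k := yr k + yl k
noncomputable def alphaX : Ae k := xr k - xl k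
noncomputable def alphaY : Ae k := yr k - yl k

/-- The `n`-th term of the resolution: the free module with generators `f n 0, …, f n n`. -/
abbrev P (n : ℕ) : Type u := Fin (n + 1) → Ae k

/-- The generator `f n i`, with the convention that it is zero unless `0 ≤ i ≤ n`. -/
noncomputable def f (n : ℕ) (i : ℤ) : P k n := fun j => if ((j : ℕ) : ℤ) = i then 1 else 0

/-- The image of the generator `f (n + 1) i` under the differential. -/
noncomputable def dGen (n : ℕ) (i : ℤ) : P k n :=
  if Even (n + 1) then (-1 : Ae k) ^ i.natAbs • (betaY k • f k n i + betaX k • f k n (i - 1))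
  else (-1 : Ae k) ^ i.natAbs • (alphaY k • f k n i - alphaX k • f k n (i - 1))

/-- The differential `P (n + 1) → P n`. -/
noncomputable def d (n : ℕ) : P k (n + 1) →ₗ[Ae k] P k n :=
  Fintype.linearCombination (Ae k) fun i : Fin (n + 2) => dGen k n (i : ℕ)

theorem d_apply {n : ℕ} (z : P k (n + 1)) (j : Fin (n + 1)) :
    d k n z j = z j.castSucc * dGen k n (j : ℕ) j + z j.succ * dGen k n ((j : ℕ) + 1) j := by
  have h1 : ∀ i : Fin (n + 2), i ≠ j.castSucc → i ≠ j.succ →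
      z i * dGen k n (i : ℕ) j = 0 := by
    intro i h h'
    have e1 : ¬ ((j : ℕ) : ℤ) = (i : ℕ) := fun h2 => h (Fin.ext (by simp; omega))
    have e2 : ¬ ((j : ℕ) : ℤ) = (i : ℕ) - 1 := fun h2 => h' (Fin.ext (by simp; omega))
    rw [dGen]
    split_ifs <;> simp [f, e1, e2]
  have hne : j.castSucc ≠ j.succ := (Fin.castSucc_lt_succ (i := j)).ne
  rw [d, Fintype.linearCombination_apply, Finset.sum_apply]
  simp only [Pi.smul_apply, smul_eq_mul]
  rw [Fintype.sum_eq_add _ _ hne (fun i h => h1 i h.1 h.2)]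
  simp

theorem ae_mul_neg (a b : Ae k) : a * -b = -(a * b) := @mul_neg (Ae k) _ _ a b
theorem ae_neg_mul (a b : Ae k) : -a * b = -(a * b) := @neg_mul (Ae k) _ _ a b

theorem neg_one_pow_comm (z : Ae k) (m : ℕ) : z * (-1) ^ m = (-1) ^ m * z :=
  ((Commute.neg_one_right z).pow_right m).eq

theorem natAbs_succ (m : ℕ) : ((m : ℤ) + 1).natAbs = m + 1 := by omega

theorem d_even {n : ℕ} (hn : Even (n + 1)) (z : P k (n + 1)) (j : Fin (n + 1)) :
    d k n z j = (-1) ^ (j : ℕ) * (z j.castSucc * betaY k - z j.succ * betaX k) := by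
  rw [d_apply]
  have e : ¬ ((j : ℕ) : ℤ) = (j : ℕ) - 1 := by omega
  simp [dGen, hn, f, natAbs_succ, pow_succ, ← mul_assoc, neg_one_pow_comm, ae_mul_neg, ae_neg_mul, mul_add,
    sub_eq_add_neg]

theorem d_odd {n : ℕ} (hn : ¬ Even (n + 1)) (z : P k (n + 1)) (j : Fin (n + 1)) :
    d k n z j = (-1) ^ (j : ℕ) * (z j.castSucc * alphaY k + z j.succ * alphaX k) := by
  rw [d_apply]
  have e : ¬ ((j : ℕ) : ℤ) = (j : ℕ) - 1 := by omega
  simp [dGen, hn, f, natAbs_succ, pow_succ, mul_add, ← mul_assoc, neg_one_pow_comm, ae_mul_neg, ae_neg_mul, e]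


section relations

theorem xl_xl : xl k * xl k = 0 := by simp [xl, x_mul_x]
theorem xr_xr : xr k * xr k = 0 := by simp [xr, ← MulOpposite.op_mul, x_mul_x]
theorem yl_yl : yl k * yl k = 0 := by simp [yl, y_mul_y]
theorem yr_yr : yr k * yr k = 0 := by simp [yr, ← MulOpposite.op_mul, y_mul_y]
theorem xr_xl : xr k * xl k = xl k * xr k := by simp [xr, xl]
theorem yr_yl : yr k * yl k = yl k * yr k := by simp [yr, yl]
theorem xr_yl : xr k * yl k = yl k * xr k := by simp [xr, yl]
theorem yr_xl : yr k * xl k = xl k * yr k := by simp [yr, xl]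
theorem yl_xl : yl k * xl k = -(xl k * yl k) := by
  simp [yl, xl, y_mul_x, TensorProduct.neg_tmul]
theorem yr_xr : yr k * xr k = -(xr k * yr k) := by
  simp [yr, xr, ← MulOpposite.op_mul, y_mul_x, TensorProduct.tmul_neg]

theorem betaX_alphaX : betaX k * alphaX k = 0 := by
  simp [betaX, alphaX, add_mul, mul_sub, xl_xl, xr_xr, xr_xl]
theorem alphaX_betaX : alphaX k * betaX k = 0 := by
  simp [betaX, alphaX, sub_mul, mul_add, xl_xl, xr_xr, xr_xl]
theorem betaY_alphaY : betaY k * alphaY k = 0 := by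
  simp [betaY, alphaY, add_mul, mul_sub, yl_yl, yr_yr, yr_yl]
theorem alphaY_betaY : alphaY k * betaY k = 0 := by
  simp [betaY, alphaY, sub_mul, mul_add, yl_yl, yr_yr, yr_yl]
theorem alphaX_betaY : alphaX k * betaY k = -(alphaY k * betaX k) := by
  simp only [alphaX, alphaY, betaX, betaY, sub_mul, mul_add, yl_xl, yr_xr, xr_yl, yr_xl]
  abel
theorem betaX_alphaY : betaX k * alphaY k = -(betaY k * alphaX k) := by
  simp only [alphaX, alphaY, betaX, betaY, add_mul, mul_sub, yl_xl, yr_xr, xr_yl, yr_xl]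
  abel

end relations

theorem d_comp_d (n : ℕ) (z : P k (n + 2)) : d k n (d k (n + 1) z) = 0 := by
  ext j
  by_cases hn : Even (n + 1)
  · have hn' : ¬ Even (n + 1 + 1) := by simpa [Nat.even_add_one] using hn
    rw [d_even k hn, d_odd k hn', d_odd k hn']
    simp [pow_succ, ae_mul_neg, ae_neg_mul, mul_assoc, add_mul, alphaY_betaY, alphaX_betaX,
      alphaX_betaY]
  · have hn' : Even (n + 1 + 1) := by simpa [Nat.even_add_one] using hn
    rw [d_odd k hn, d_even k hn', d_even k hn']
    simp [pow_succ, ae_mul_neg, ae_neg_mul, mul_assoc, sub_mul, betaY_alphaY, betaX_alphaX,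
      betaX_alphaY]

section homotopy

/-! The operators `opP`, `opL`, `opE`, `opT` serve to show that the complex is exact: on the basis
`1, y, x, y * x` of the algebra, `opP` is the projection to the span of `1, y`, `opL` strips a
right factor `x`, `opE` is the augmentation, and `opT` is the coefficient of `y`. -/

noncomputable def phi : Alg k →ₐ[k] Matrix (Fin 2) (Fin 2) (Alg k) :=
  lift k !![0, 1; 0, 0] !![y k, 0; 0, -y k] (by simp [← Matrix.ext_iff]) (by simp [← Matrix.ext_iff])
    (by simp [← Matrix.ext_iff, y_mul_y])

noncomputable def psi : Alg k →ₐ[k] Matrix (Fin 2) (Fin 2) k :=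
  lift k 0 !![0, 1; 0, 0] (by simp) (by simp) (by simp [← Matrix.ext_iff])

noncomputable def opP : Alg k →ₗ[k] Alg k :=
  Matrix.entryLinearMap k (Alg k) 0 0 ∘ₗ (phi k).toLinearMap

noncomputable def opL : Alg k →ₗ[k] Alg k :=
  Matrix.entryLinearMap k (Alg k) 0 1 ∘ₗ (phi k).toLinearMap

noncomputable def opE : Alg k →ₗ[k] Alg k :=
  Algebra.linearMap k (Alg k) ∘ₗ Matrix.entryLinearMap k k 0 0 ∘ₗ (psi k).toLinearMap

noncomputable def opT : Alg k →ₗ[k] Alg k :=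
  Algebra.linearMap k (Alg k) ∘ₗ Matrix.entryLinearMap k k 0 1 ∘ₗ (psi k).toLinearMap

variable (a : Alg k)

theorem opP_one : opP k 1 = 1 := by simp [opP]
theorem opL_one : opL k 1 = 0 := by simp [opL]
theorem opE_one : opE k 1 = 1 := by simp [opE]
theorem opT_one : opT k 1 = 0 := by simp [opT]
theorem opP_x : opP k (a * x k) = 0 := by
  simp [opP, phi, lift_x, Matrix.mul_apply, Fin.sum_univ_two]
theorem opP_y : opP k (a * y k) = opP k a * y k := by
  simp [opP, phi, lift_y, Matrix.mul_apply, Fin.sum_univ_two]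
theorem opL_x : opL k (a * x k) = opP k a := by
  simp [opP, opL, phi, lift_x, Matrix.mul_apply, Fin.sum_univ_two]
theorem opL_y : opL k (a * y k) = -(opL k a * y k) := by
  simp [opL, phi, lift_y, Matrix.mul_apply, Fin.sum_univ_two]
theorem opE_x : opE k (a * x k) = 0 := by
  simp [opE, psi, lift_x]
theorem opE_y : opE k (a * y k) = 0 := by
  simp [opE, psi, lift_y, Matrix.mul_apply, Fin.sum_univ_two]
theorem opT_x : opT k (a * x k) = 0 := by
  simp [opT, psi, lift_x]
theorem opT_y : opT k (a * y k) = opE k a := by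
  simp [opT, opE, psi, lift_y, Matrix.mul_apply, Fin.sum_univ_two]

theorem opP_add_opL : opP k a + opL k a * x k = a := by
  induction a using alg_induction with
  | one => simp [opP_one, opL_one]
  | add a b ha hb => rw [map_add, map_add, add_mul]; nth_rw 3 [← ha, ← hb]; abel
  | smul c a ha => rw [map_smul, map_smul, smul_mul_assoc, ← smul_add, ha]
  | mul_x a ha =>
    have := congrArg (· * x k) ha
    simpa [opP_x, opL_x, add_mul, mul_assoc, x_mul_x] using this
  | mul_y a ha =>
    have := congrArg (· * y k) ha
    simpa [opP_y, opL_y, add_mul, mul_assoc, y_mul_x] using this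

theorem opP_opP : opP k (opP k a) = opP k a := by
  induction a using alg_induction with
  | one => simp [opP_one]
  | add a b ha hb => simp only [map_add, ha, hb]
  | smul c a ha => simp only [map_smul, ha]
  | mul_x a ha => simp [opP_x]
  | mul_y a ha => simp [opP_y, ha]

theorem opP_opL : opP k (opL k a) = opL k a := by
  induction a using alg_induction with
  | one => simp [opL_one]
  | add a b ha hb => simp only [map_add, ha, hb]
  | smul c a ha => simp only [map_smul, ha]
  | mul_x a ha => simp [opL_x, opP_opP]
  | mul_y a ha => simp [opL_y, opP_y, ha]

theorem opE_add_opT : opE k a + opT k a * y k = opP k a := by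
  induction a using alg_induction with
  | one => simp [opE_one, opT_one, opP_one]
  | add a b ha hb => rw [map_add, map_add, map_add, add_mul, ← ha, ← hb]; abel
  | smul c a ha => rw [map_smul, map_smul, map_smul, smul_mul_assoc, ← smul_add, ha]
  | mul_x a ha => simp [opE_x, opT_x, opP_x]
  | mul_y a ha =>
    rw [opE_y, opT_y, opP_y, ← ha]
    simp [add_mul, mul_assoc, y_mul_y]

noncomputable def PP : Ae k →ₗ[k] Ae k := (opP k).rTensor _
noncomputable def LL : Ae k →ₗ[k] Ae k := (opL k).rTensor _
noncomputable def EE : Ae k →ₗ[k] Ae k := (opE k).rTensor _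
noncomputable def TT : Ae k →ₗ[k] Ae k := (opT k).rTensor _

variable (z : Ae k)

theorem LL_xl : LL k (z * xl k) = PP k z := by
  induction z using TensorProduct.induction_on with
  | zero => simp
  | tmul a b => simp [LL, PP, xl, opL_x]
  | add a b ha hb => simp only [add_mul, map_add, ha, hb]

theorem LL_yl : LL k (z * yl k) = -(LL k z * yl k) := by
  induction z using TensorProduct.induction_on with
  | zero => simp
  | tmul a b => simp [LL, yl, opL_y, TensorProduct.neg_tmul]
  | add a b ha hb => simp only [add_mul, map_add, ha, hb, neg_add]

theorem LL_xr : LL k (z * xr k) = LL k z * xr k := by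
  induction z using TensorProduct.induction_on with
  | zero => simp
  | tmul a b => simp [LL, xr]
  | add a b ha hb => simp only [add_mul, map_add, ha, hb]

theorem LL_yr : LL k (z * yr k) = LL k z * yr k := by
  induction z using TensorProduct.induction_on with
  | zero => simp
  | tmul a b => simp [LL, yr]
  | add a b ha hb => simp only [add_mul, map_add, ha, hb]

theorem PP_xr : PP k (z * xr k) = PP k z * xr k := by
  induction z using TensorProduct.induction_on with
  | zero => simp
  | tmul a b => simp [PP, xr]
  | add a b ha hb => simp only [add_mul, map_add, ha, hb]

theorem LL_mul_xl : LL k z * xl k = z - PP k z := by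
  rw [eq_sub_iff_add_eq']
  induction z using TensorProduct.induction_on with
  | zero => simp
  | tmul a b => simp [LL, PP, xl, ← TensorProduct.add_tmul, opP_add_opL]
  | add a b ha hb => rw [map_add, map_add, add_mul]; nth_rw 3 [← ha, ← hb]; abel

theorem PP_PP : PP k (PP k z) = PP k z := by
  induction z using TensorProduct.induction_on with
  | zero => simp
  | tmul a b => simp [PP, opP_opP]
  | add a b ha hb => simp only [map_add, ha, hb]

theorem PP_LL : PP k (LL k z) = LL k z := by
  induction z using TensorProduct.induction_on with
  | zero => simp
  | tmul a b => simp [PP, LL, opP_opL]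
  | add a b ha hb => simp only [map_add, ha, hb]

theorem TT_yl : TT k (z * yl k) = EE k z := by
  induction z using TensorProduct.induction_on with
  | zero => simp
  | tmul a b => simp [TT, EE, yl, opT_y]
  | add a b ha hb => simp only [add_mul, map_add, ha, hb]

theorem TT_yr : TT k (z * yr k) = TT k z * yr k := by
  induction z using TensorProduct.induction_on with
  | zero => simp
  | tmul a b => simp [TT, yr]
  | add a b ha hb => simp only [add_mul, map_add, ha, hb]

theorem TT_mul_yl : TT k z * yl k = PP k z - EE k z := by
  rw [eq_sub_iff_add_eq']
  induction z using TensorProduct.induction_on with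
  | zero => simp
  | tmul a b => simp [TT, PP, EE, yl, ← TensorProduct.add_tmul, opE_add_opT]
  | add a b ha hb => simp only [map_add, add_mul, ← ha, ← hb]; abel


/-- A partial contracting homotopy. -/
noncomputable def sOp {n : ℕ} (z : P k n) : P k (n + 1) :=
  Fin.cons (α := fun _ => Ae k) 0 fun j : Fin (n + 1) => (-1) ^ ((j : ℕ) + 1) * LL k (z j)

theorem neg_one_pow_sq (m : ℕ) (a : Ae k) : (-1) ^ m * ((-1) ^ m * a) = a := by
  have h : (-1 : Ae k) ^ (m + m) = 1 := @Even.neg_one_pow (Ae k) _ _ _ ⟨m, rfl⟩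
  rw [← mul_assoc, ← pow_add, h, one_mul]

theorem sq_cancel {m : ℕ} {a : Ae k} (h : (-1) ^ m * a = 0) : a = 0 := by
  rw [← neg_one_pow_sq k m a, h, mul_zero]

/-- Subtracting a boundary from a cycle leaves a multiple of `f_0` fixed by `PP`. -/
theorem reduce_even {n : ℕ} (hn : Even (n + 1)) (z : P k (n + 1)) (hz : d k n z = 0) :
    ∃ w : Ae k, PP k w = w ∧ z - d k (n + 1) (sOp k z) = Pi.single 0 w := by
  have hn' : ¬ Even (n + 1 + 1) := by simpa [Nat.even_add_one] using hn
  refine ⟨PP k (z 0) + LL k (z 0) * xr k, ?_, ?_⟩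
  · rw [map_add, PP_PP, ← LL_xr, PP_LL]
  · ext j
    refine Fin.cases ?_ (fun j => ?_) j
    · have h := LL_mul_xl k (z 0)
      simp only [Pi.sub_apply, Pi.single_eq_same, d_odd k hn', sOp, alphaX]
      simp [ae_neg_mul, mul_sub, h]
      abel
    · have h := sq_cancel k ((d_even k hn z j).symm.trans (congrFun hz j))
      have h2 := congrArg (LL k) h
      simp only [betaX, betaY, mul_add, map_sub, map_add, LL_xl, LL_xr, LL_yl, LL_yr,
        map_zero] at h2
      have h3 := LL_mul_xl k (z j.succ)
      rw [Pi.sub_apply, Pi.single_eq_of_ne (Fin.succ_ne_zero j), sub_eq_zero, d_odd k hn']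
      simp only [sOp, ← Fin.succ_castSucc, Fin.cons_succ, Fin.val_succ, Fin.val_castSucc, mul_assoc,
        mul_add, neg_one_pow_sq]
      rw [pow_succ (-1 : Ae k) ((j : ℕ) + 1)]
      simp only [mul_assoc, ae_neg_mul, ae_mul_neg, one_mul, neg_one_pow_sq, alphaX, alphaY,
        mul_sub, h3]
      rw [← sub_eq_zero, ← neg_eq_zero.mpr h2]
      abel

theorem reduce_odd {n : ℕ} (hn : ¬ Even (n + 1)) (z : P k (n + 1)) (hz : d k n z = 0) :
    ∃ w : Ae k, PP k w = w ∧ z - d k (n + 1) (sOp k z) = Pi.single 0 w := by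
  have hn' : Even (n + 1 + 1) := by simpa [Nat.even_add_one] using hn
  refine ⟨PP k (z 0) - LL k (z 0) * xr k, ?_, ?_⟩
  · rw [map_sub, PP_PP, ← LL_xr, PP_LL]
  · ext j
    refine Fin.cases ?_ (fun j => ?_) j
    · have h := LL_mul_xl k (z 0)
      simp only [Pi.sub_apply, Pi.single_eq_same, d_even k hn', sOp, betaX]
      simp [ae_neg_mul, mul_add, h]
      abel
    · have h := sq_cancel k ((d_odd k hn z j).symm.trans (congrFun hz j))
      have h2 := congrArg (LL k) h
      simp only [alphaX, alphaY, mul_sub, map_sub, map_add, LL_xl, LL_xr, LL_yl, LL_yr,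
        map_zero] at h2
      have h3 := LL_mul_xl k (z j.succ)
      rw [Pi.sub_apply, Pi.single_eq_of_ne (Fin.succ_ne_zero j), sub_eq_zero, d_even k hn']
      simp only [sOp, ← Fin.succ_castSucc, Fin.cons_succ, Fin.val_succ, Fin.val_castSucc, mul_assoc,
        mul_sub, neg_one_pow_sq]
      rw [pow_succ (-1 : Ae k) ((j : ℕ) + 1)]
      simp only [mul_assoc, ae_neg_mul, ae_mul_neg, one_mul, neg_one_pow_sq, betaX, betaY,
        mul_add, h3]
      rw [← sub_eq_zero, ← neg_eq_zero.mpr h2]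
      abel

theorem exact_succ {n : ℕ} (z : P k (n + 1)) (hz : d k n z = 0) :
    ∃ u : P k (n + 2), d k (n + 1) u = z := by
  by_cases hn : Even (n + 1)
  · have hn' : ¬ Even (n + 1 + 1) := by simpa [Nat.even_add_one] using hn
    obtain ⟨w, hw, e⟩ := reduce_even k hn z hz
    have hc : d k n (Pi.single 0 w) = 0 := by rw [← e, map_sub, hz, d_comp_d, sub_zero]
    have h0 := congrFun hc 0
    rw [d_even k hn] at h0
    simp [betaY] at h0
    have h1 := congrArg (TT k) h0
    simp only [mul_add, map_add, TT_yl, TT_yr, map_zero] at h1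
    refine ⟨sOp k z - Pi.single 0 (TT k w), ?_⟩
    rw [map_sub, sub_eq_iff_eq_add, ← sub_eq_iff_eq_add', ← neg_inj, neg_sub, e]
    ext j
    rw [Pi.neg_apply, d_odd k hn']
    refine Fin.cases ?_ (fun j => ?_) j
    · have h3 := TT_mul_yl k w
      simp [alphaY, mul_sub, h3, hw]
      rw [← sub_eq_zero, ← h1]
      abel
    · rw [← Fin.succ_castSucc, Pi.single_eq_of_ne (Fin.succ_ne_zero _),
        Pi.single_eq_of_ne (Fin.succ_ne_zero _), Pi.single_eq_of_ne (Fin.succ_ne_zero _)]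
      simp
  · have hn' : Even (n + 1 + 1) := by simpa [Nat.even_add_one] using hn
    obtain ⟨w, hw, e⟩ := reduce_odd k hn z hz
    have hc : d k n (Pi.single 0 w) = 0 := by rw [← e, map_sub, hz, d_comp_d, sub_zero]
    have h0 := congrFun hc 0
    rw [d_odd k hn] at h0
    simp [alphaY] at h0
    have h1 := congrArg (TT k) h0
    simp only [mul_sub, map_sub, TT_yl, TT_yr, map_zero] at h1
    refine ⟨sOp k z + Pi.single 0 (TT k w), ?_⟩
    rw [map_add, ← eq_sub_iff_add_eq', e]
    ext j
    rw [d_even k hn']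
    refine Fin.cases ?_ (fun j => ?_) j
    · have h3 := TT_mul_yl k w
      simp [betaY, mul_add, h3, hw]
      rw [← sub_eq_zero, ← h1]
      abel
    · rw [← Fin.succ_castSucc, Pi.single_eq_of_ne (Fin.succ_ne_zero _),
        Pi.single_eq_of_ne (Fin.succ_ne_zero _), Pi.single_eq_of_ne (Fin.succ_ne_zero _)]
      simp


theorem smul_alg (a : Alg k) (b : (Alg k)ᵐᵒᵖ) (c : Alg k) :
    (a ⊗ₜ[k] b : Ae k) • c = a * (c * b.unop) := rfl

/-- The augmentation `P 0 → A`, sending the generator to `1`. -/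
noncomputable def mu : P k 0 →ₗ[Ae k] Alg k :=
  Fintype.linearCombination (Ae k) fun _ : Fin 1 => (1 : Alg k)

theorem mu_apply (z : P k 0) : mu k z = z 0 • (1 : Alg k) := by
  simp [mu, Fintype.linearCombination_apply]

theorem mu_surjective : Function.Surjective (mu k) := fun a =>
  ⟨fun _ => a ⊗ₜ 1, by simp [mu_apply, smul_alg]⟩

theorem mu_d (z : P k 1) : mu k (d k 0 z) = 0 := by
  rw [mu_apply, d_odd k (by simp)]
  have hy : alphaY k • (1 : Alg k) = 0 := by
    simp [alphaY, sub_smul, yr, yl, smul_alg]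
  have hx : alphaX k • (1 : Alg k) = 0 := by
    simp [alphaX, sub_smul, xr, xl, smul_alg]
  simp [add_smul, mul_smul, hx, hy]

theorem EE_add_TT : EE k z + TT k z * yr k = 1 ⊗ₜ MulOpposite.op (PP k z • (1 : Alg k)) := by
  induction z using TensorProduct.induction_on with
  | zero =>
    have h : (0 : Ae k) • (1 : Alg k) = 0 := by
      rw [← TensorProduct.zero_tmul (Alg k) (1 : (Alg k)ᵐᵒᵖ), smul_alg, zero_mul]
    simp [h]
  | tmul a b =>
    obtain ⟨c, hc⟩ : ∃ c : k, opE k a = c • 1 :=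
      ⟨psi k a 0 0, Algebra.algebraMap_eq_smul_one (psi k a 0 0)⟩
    obtain ⟨t, ht⟩ : ∃ t : k, opT k a = t • 1 :=
      ⟨psi k a 0 1, Algebra.algebraMap_eq_smul_one (psi k a 0 1)⟩
    simp [TT, PP, EE, yr, smul_alg, ← opE_add_opT, hc, ht, add_mul, TensorProduct.tmul_add,
      TensorProduct.smul_tmul]
    rw [TensorProduct.smul_tmul', TensorProduct.smul_tmul', Algebra.TensorProduct.tmul_mul_tmul,
      mul_one]
  | add a b ha hb =>
    simp only [map_add, add_mul, add_smul, MulOpposite.op_add, TensorProduct.tmul_add, ← ha, ← hb]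
    abel

theorem exact_zero (z : P k 0) (hz : mu k z = 0) : ∃ u : P k 1, d k 0 u = z := by
  set w : Ae k := PP k (z 0) + LL k (z 0) * xr k with hwdef
  have hw : PP k w = w := by rw [hwdef, map_add, PP_PP, ← LL_xr, PP_LL]
  have e : z - d k 0 (sOp k z) = Pi.single 0 w := by
    ext j
    obtain rfl : j = 0 := Subsingleton.elim (α := Fin 1) _ _
    have h := LL_mul_xl k (z 0)
    simp only [Pi.sub_apply, Pi.single_eq_same, d_odd k (n := 0) (by simp), sOp, alphaX]
    simp [ae_neg_mul, mul_sub, h]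
    rw [hwdef]
    abel
  have hm : w • (1 : Alg k) = 0 := by
    have : mu k (Pi.single 0 w) = 0 := by rw [← e, map_sub, hz, mu_d, sub_zero]
    simpa [mu_apply] using this
  have h1 := EE_add_TT k w
  rw [hw, hm, MulOpposite.op_zero, TensorProduct.tmul_zero] at h1
  refine ⟨sOp k z - Pi.single 0 (TT k w), ?_⟩
  rw [map_sub, sub_eq_iff_eq_add, ← sub_eq_iff_eq_add', ← neg_inj, neg_sub, e]
  ext j
  obtain rfl : j = 0 := Subsingleton.elim (α := Fin 1) _ _
  rw [Pi.neg_apply, d_odd k (by simp)]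
  have h3 := TT_mul_yl k w
  simp [alphaY, mul_sub, h3, hw]
  rw [← sub_eq_zero, ← h1]
  abel

end homotopy


/-- The complex of bimodules with terms `P n` and differentials `d n`. -/
noncomputable def complex : ChainComplex (ModuleCat.{u} (Ae k)) ℕ :=
  ChainComplex.of (fun n => ModuleCat.of (Ae k) (P k n)) (fun n => ModuleCat.ofHom (d k n))
    (fun n => by ext1; exact LinearMap.ext (d_comp_d k n))

theorem complex_d (n : ℕ) : (complex k).d (n + 1) n = ModuleCat.ofHom (d k n) :=
  by
  exact ChainComplex.of_d (fun n => ModuleCat.of (Ae k) (P k n))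
    (fun n => ModuleCat.ofHom (d k n)) n

theorem complex_d_apply (n : ℕ) (z : P k (n + 1)) :
    ((complex k).d (n + 1) n).hom z = d k n z := by
  rw [complex_d]; rfl

/-- The augmentation as a map of complexes. -/
noncomputable def aug : complex k ⟶ (ChainComplex.single₀ (ModuleCat.{u} (Ae k))).obj
    (bimodule k (Alg k)) :=
  ((complex k).toSingle₀Equiv (bimodule k (Alg k))).symm ⟨ModuleCat.ofHom (mu k), by
    rw [complex_d]
    ext1
    exact LinearMap.ext (mu_d k)⟩

theorem quasiIso_aug : QuasiIso (aug k) where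
  quasiIsoAt m := by
    cases m with
    | zero =>
      rw [ChainComplex.quasiIsoAt₀_iff, ShortComplex.quasiIso_iff_of_zeros' _ rfl rfl rfl]
      constructor
      · rw [ShortComplex.moduleCat_exact_iff]
        intro z hz
        have hz' : mu k z = 0 := hz
        obtain ⟨u, hu⟩ := exact_zero k z hz'
        exact ⟨u, (complex_d_apply k 0 u).trans hu⟩
      · rw [ModuleCat.epi_iff_surjective]
        exact mu_surjective k
    | succ m =>
      rw [quasiIsoAt_iff_exactAt' (hL := ChainComplex.exactAt_succ_single_obj ..),
          HomologicalComplex.exactAt_iff' _ (m + 2) (m + 1) m (by simp) (by simp),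
          ShortComplex.moduleCat_exact_iff]
      intro z hz
      have hz' : d k m z = 0 := (complex_d_apply k m z).symm.trans hz
      obtain ⟨u, hu⟩ := exact_succ k z hz'
      exact ⟨u, (complex_d_apply k (m + 1) u).trans hu⟩

/-- The bimodule resolution of the algebra given by the terms `P n` and differentials `d n`. -/
noncomputable def resolution : ProjectiveResolution (bimodule k (Alg k)) where
  complex := complex k
  projective n :=
    (ModuleCat.of (Ae k) (P k n)).projective_of_categoryTheory_projective
  π := aug k
  quasiIso := quasiIso_aug k

/-- The map `P n → A` with `f n i ↦ 1` for `i = r` and `f n i ↦ 0` otherwise. -/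
noncomputable def xiMap (n : ℕ) (r : Fin (n + 1)) : P k n →ₗ[Ae k] Alg k :=
  Fintype.linearCombination (Ae k) fun i : Fin (n + 1) => if i = r then (1 : Alg k) else 0

theorem xiMap_apply (n : ℕ) (r : Fin (n + 1)) (z : P k n) : xiMap k n r z = z r • (1 : Alg k) := by
  simp [xiMap, Fintype.linearCombination_apply]

theorem xiMap_d (t : ℕ) (r : Fin (2 * t + 1)) (z : P k (2 * t + 1)) :
    xiMap k (2 * t) r (d k (2 * t) z) = 0 := by
  have hy : alphaY k • (1 : Alg k) = 0 := by
    simp [alphaY, sub_smul, yr, yl, smul_alg]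
  have hx : alphaX k • (1 : Alg k) = 0 := by
    simp [alphaX, sub_smul, xr, xl, smul_alg]
  rw [xiMap_apply, d_odd k (by simp)]
  simp [add_smul, mul_smul, hx, hy]

/-- The class of the cocycle `xiMap k (2 * t) r` in `HH²ᵗ`. -/
noncomputable def xi (t : ℕ) (r : Fin (2 * t + 1)) : HH k (Alg k) (2 * t) :=
  (resolution k).extMk (ModuleCat.ofHom (xiMap k (2 * t) r)) (2 * t + 1) rfl (by
    change (complex k).d _ _ ≫ _ = 0
    rw [complex_d]
    ext1
    exact LinearMap.ext (xiMap_d k t r))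

/-- The subalgebra of the even Hochschild cohomology ring generated by all classes `xi k t r`. -/
noncomputable def R : Subalgebra k (HHEvenRing k (Alg k)) :=
  Algebra.adjoin k
    {z | ∃ (t : ℕ) (r : Fin (2 * t + 1)), z = DirectSum.of (HHEven k (Alg k)) t (xi k t r)}

end

end QCI

/-! Applying Hom(-, A) to the resolution gives cochains whose values on the generators lie in A,
which has basis 1, x, y, xy. The differential out of an even degree acts through commutators with x
and y: it kills 1 and xy and sends x, y to multiples of 2xy. The differential into an even degree
acts through anticommutators: it sends 1 to 2x and 2y and kills the rest. As 2 is invertible, a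
cocycle of even degree has arbitrary coefficients at 1 and xy, and its x, y part is a coboundary.
Hence every even class is a combination of the `xi` plus a multiple of `zeta`, the class of xy
(`eq_sum_xi_add`), and the constant terms depend only on the class (`coord_zero_of_cls_eq_zero`).

For the products, `xi` with index r lifts to a chain map that shifts generator indices by r up to
sign. By `extMk_comp_extMk` the Yoneda product is computed from such lifts, so indices and degrees
add (`xi_comp_xi`). Since xy is central with square zero, `zeta` is central with square zero.

Reading constant terms therefore gives an algebra map `symbolHom` to polynomials in two variables,
with `xi k t r` going to X^r Y^t. It is injective on R, and its kernel is the ideal generated by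
`zeta`, which is homogeneous with square zero. The target is a domain, so every nilpotent ideal lies
in the kernel. The kernel is thus the required ideal, and it is a complement of R. -/

namespace CochainComplex.HomComplex

/-! ### Composition of cocycles and of shifted morphisms -/

open Category

variable {C : Type*} [Category* C] [Preadditive C] {K L M : CochainComplex C ℤ}

/-- Right-shifting a cochain introduces no sign, so composing cocycles matches composing shifted
maps with no Koszul sign. -/
theorem Cocycle.equivHomShift_symm_comp {a b c : ℤ} (z₁ : Cocycle K L a) (z₂ : Cocycle L M b)
    (z : Cocycle K M c) (h : b + a = c) (hz : z.1 = z₁.1.comp z₂.1 (by lia)) :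
    Cocycle.equivHomShift.symm z =
      ShiftedHom.comp (Cocycle.equivHomShift.symm z₁) (Cocycle.equivHomShift.symm z₂) h := by
  subst h
  ext p
  simp [ShiftedHom.comp, Cocycle.equivHomShift_symm_apply, hz,
    Cochain.rightShift_v _ _ _ _ p p (add_zero p) _ rfl,
    Cochain.rightShift_v _ _ _ _ (p + a) (p + a) (add_zero (p + a)) _ rfl,
    CochainComplex.shiftFunctorAdd'_inv_app_f', HomologicalComplex.XIsoOfEq]
  rw [Cochain.comp_v _ _ _ p (p + a) (p + (b + a)) rfl (by lia),
    ← z₂.1.v_comp_XIsoOfEq_hom (p + a) (p + a + b) (p + (b + a)) rfl (by lia)]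
  have aux {A B D E : C} (α : A ⟶ B) (β : B ⟶ D) (γ : D ⟶ E) :
      (α ≫ β ≫ γ) ≫ 𝟙 E = (α ≫ 𝟙 B) ≫ (β ≫ 𝟙 D) ≫ γ := by simp
  exact aux _ _ _

end CochainComplex.HomComplex

/-- A class computed on a resolution is a shifted map of complexes flanked by degree-zero comparison
maps. When two classes are multiplied, the inner comparisons `i` and `v` meet and cancel. -/
theorem CategoryTheory.ShiftedHom.mk₀_comp_comp_mk₀ {D : Type*} [Category* D] {M : Type*}
    [AddMonoid M] [HasShift D M] {A K L B N E : D} {a b c : M} (u : A ⟶ K) (F : ShiftedHom K L a)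
    (i : L ⟶ B) (v : B ⟶ L) (G : ShiftedHom L N b) (w : N ⟶ E) (hiv : i ≫ v = 𝟙 L)
    (h : b + a = c) :
    ((mk₀ 0 rfl u).comp (F.comp (mk₀ 0 rfl i) (zero_add a)) (add_zero a)).comp
        ((mk₀ 0 rfl v).comp (G.comp (mk₀ 0 rfl w) (zero_add b)) (add_zero b)) h =
      (mk₀ 0 rfl u).comp ((F.comp G h).comp (mk₀ 0 rfl w) (zero_add c)) (add_zero c) := by
  simp only [mk₀_comp, comp_mk₀]
  have e : (v ≫ G ≫ w⟦b⟧')⟦a⟧' = v⟦a⟧' ≫ G⟦a⟧' ≫ (w⟦b⟧')⟦a⟧' := by simp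
  have e' : i⟦a⟧' ≫ v⟦a⟧' = 𝟙 _ := by rw [← Functor.map_comp, hiv, Functor.map_id]
  have n := (shiftFunctorAdd' D b a c h).inv.naturality w
  simp only [Functor.comp_map] at n
  simp [comp, e, reassoc_of% e', n]

theorem CategoryTheory.comp_eq_comp_inv_comp_hom {C : Type*} [Category* C] {A B D D' E : C}
    (α : A ⟶ B) (β : B ⟶ D') (e : D ≅ D') (γ : D' ⟶ E) :
    (α ≫ β ≫ γ) = (α ≫ β ≫ e.inv) ≫ e.hom ≫ γ := by
  simp

/-! ### Yoneda products through lifts to chain maps -/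

namespace CategoryTheory.ProjectiveResolution

open CochainComplex HomComplex Limits

variable {C : Type*} [Category* C] [Abelian C] {X Y Z : C}
  (R : ProjectiveResolution X) (S : ProjectiveResolution Y)

variable {R S} in
/-- A chain map `R.complex[m] ⟶ S.complex`, seen as a cochain of degree `m`. -/
noncomputable def shiftCochain {m : ℕ} (φ : ∀ j, R.complex.X (m + j) ⟶ S.complex.X j) :
    Cochain R.cochainComplex S.cochainComplex (m : ℤ) :=
  -- Homological degree j sits in cochain degree -j, so for q > 0 the target is a zero object and
  -- the default 0 loses nothing.
  Cochain.mk fun p q hpq => if hq : q ≤ 0 then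
    (R.cochainComplexXIso p (m + (-q).toNat) (by lia)).hom ≫ φ (-q).toNat ≫
      (S.cochainComplexXIso q (-q).toNat (by lia)).inv else 0

theorem shiftCochain_v {m : ℕ} (φ : ∀ j, R.complex.X (m + j) ⟶ S.complex.X j) {p q : ℤ}
    (hpq : p + m = q) (j : ℕ) (hp : -((m + j : ℕ) : ℤ) = p) (hj : -(j : ℤ) = q) :
    (shiftCochain φ).v p q hpq =
      (R.cochainComplexXIso p (m + j) hp).hom ≫ φ j ≫ (S.cochainComplexXIso q j hj).inv := by
  obtain rfl : (-q).toNat = j := by lia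
  rw [shiftCochain, Cochain.mk_v, dif_pos (by lia)]

/-- In the Hom complex the two terms of `δ` differ by the sign (-1)^(m+1). For even m this is -1, so
being closed is commuting with the differentials on the nose. -/
theorem shiftCochain_mem {m : ℕ} (hm : Even m)
    (φ : ∀ j, R.complex.X (m + j) ⟶ S.complex.X j)
    (hφ : ∀ j, R.complex.d (m + (j + 1)) (m + j) ≫ φ j = φ (j + 1) ≫ S.complex.d (j + 1) j) :
    δ (m : ℤ) (m + 1) (shiftCochain φ) = 0 := by
  ext p q hpq
  by_cases hq : q ≤ 0
  · obtain ⟨j, rfl⟩ : ∃ j : ℕ, q = -(j : ℤ) := ⟨(-q).toNat, by lia⟩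
    have hs : ((m : ℤ) + 1).negOnePow = -1 := Int.negOnePow_odd _ (by
      obtain ⟨a, rfl⟩ := hm; exact ⟨a, by push_cast; ring⟩)
    rw [δ_v _ _ rfl _ _ _ hpq (-(j : ℤ) - 1) (p + 1) rfl rfl, 
      shiftCochain_v R S φ _ (j + 1) (by lia) (by lia),
      shiftCochain_v R S φ _ j (by lia) (by lia), hs,
      R.cochainComplex_d _ _ (m + (j + 1)) (m + j) (by lia) (by lia),
      S.cochainComplex_d _ _ (j + 1) j (by lia) (by lia)]
    simp [reassoc_of% hφ]
  · exact (isZero_of_isStrictlyLE S.cochainComplex 0 q (by lia)).eq_of_tgt _ _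

variable {R S} in
-- The target complex is concentrated in degree 0, so only the component `φ 0` contributes, and it
-- lifts `f` through the augmentation.
theorem toSingleMk_eq_postcomp {m : ℕ} (φ : ∀ j, R.complex.X (m + j) ⟶ S.complex.X j)
    (f : R.complex.X m ⟶ Y)
    (hfφ : f = φ 0 ≫ S.π.f 0) :
    Cochain.toSingleMk ((R.cochainComplexXIso (-m) m rfl).hom ≫ f) (n := m) (by simp) =
      (shiftCochain φ).comp (Cochain.ofHom S.π') (add_zero _) := by
  ext p q hpq
  by_cases hq : q = 0
  · subst hq
    obtain rfl : p = -(m : ℤ) := by lia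
    rw [Cochain.toSingleMk_v, Cochain.comp_v _ _ _ _ _ _ hpq (by lia),
      shiftCochain_v R S φ hpq 0 (by lia) (by lia), Cochain.ofHom_v, S.π'_f_zero, hfφ]
    refine (Category.assoc _ _ _).trans (Eq.trans ?_ (comp_eq_comp_inv_comp_hom _ _ _ _))
    exact congrArg _ (Category.assoc _ _ _)
  · exact (HomologicalComplex.isZero_single_obj_X _ _ _ _ hq).eq_of_tgt _ _

variable {R S} in
-- Again only target degree 0 counts; it is reached through degree -n of the middle complex, where
-- the cochain is `φ n`.
theorem toSingleMk_eq_comp {m n : ℕ} (φ : ∀ j, R.complex.X (m + j) ⟶ S.complex.X j)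
    (g : S.complex.X n ⟶ Z) (h : R.complex.X (m + n) ⟶ Z) (hgh : h = φ n ≫ g) :
    Cochain.toSingleMk ((R.cochainComplexXIso (-(m + n : ℕ)) (m + n) rfl).hom ≫ h)
        (n := (m + n : ℕ)) (by simp : _ = (0 : ℤ)) =
      (shiftCochain φ).comp
        (Cochain.toSingleMk ((S.cochainComplexXIso (-n) n rfl).hom ≫ g) (n := n)
          (by simp : _ = (0 : ℤ))) (by simp) := by
  ext p q hpq
  by_cases hq : q = 0
  · subst hq
    obtain rfl : p = -((m + n : ℕ) : ℤ) := by lia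
    rw [Cochain.toSingleMk_v, Cochain.comp_v _ _ _ _ (-n : ℤ) _ (by lia) (by lia),
      shiftCochain_v R S φ _ n (by lia) (by lia), Cochain.toSingleMk_v, hgh]
    have aux {A B D D' E F : C} (α : A ⟶ B) (β : B ⟶ D') (e : D ≅ D') (γ : D' ⟶ E) (ε : E ⟶ F) :
        (α ≫ β ≫ γ) ≫ ε = (α ≫ β ≫ e.inv) ≫ (e.hom ≫ γ) ≫ ε := by simp
    exact aux _ _ _ _ _
  · exact (HomologicalComplex.isZero_single_obj_X _ _ _ _ hq).eq_of_tgt _ _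

/-- The cocycle of degree `n` given by a morphism `R.complex.X n ⟶ Y`. -/
noncomputable def cocycleMk {n : ℕ} (f : R.complex.X n ⟶ Y)
    (hf : R.complex.d (n + 1) n ≫ f = 0) :
    Cocycle R.cochainComplex ((CochainComplex.singleFunctor C 0).obj Y) n :=
  Cocycle.toSingleMk ((R.cochainComplexXIso (-n) n rfl).hom ≫ f) (by simp)
    (-(n + 1 : ℕ)) (by lia) (by
      rw [cochainComplex_d _ _ _ (n + 1) n rfl rfl]
      simp [hf])

variable [HasExt C]

/-- The Yoneda product of the class of `f` of even degree `m` with the class of `g` is represented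
by the composite of `g` with a lift of `f` to a chain map. -/
theorem extMk_comp_extMk {m n : ℕ} (hm : Even m)
    (φ : ∀ j, R.complex.X (m + j) ⟶ S.complex.X j)
    (hφ : ∀ j, R.complex.d (m + (j + 1)) (m + j) ≫ φ j = φ (j + 1) ≫ S.complex.d (j + 1) j)
    (f : R.complex.X m ⟶ Y) (hf : R.complex.d (m + 1) m ≫ f = 0)
    (hfφ : f = φ 0 ≫ S.π.f 0)
    (g : S.complex.X n ⟶ Z) (hg : S.complex.d (n + 1) n ≫ g = 0)
    (h : R.complex.X (m + n) ⟶ Z) (hh : R.complex.d (m + n + 1) (m + n) ≫ h = 0)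
    (hgh : h = φ n ≫ g) :
    (R.extMk f (m + 1) rfl hf).comp (S.extMk g (n + 1) rfl hg) rfl =
      R.extMk h (m + n + 1) rfl hh := by
  have := HasDerivedCategory.standard C
  ext
  let Φ : Cocycle R.cochainComplex S.cochainComplex (m : ℤ) :=
    Cocycle.mk (shiftCochain φ) _ rfl (shiftCochain_mem R S hm φ hφ)
  have e₁ : R.cocycleMk f hf = Φ.postcomp S.π' := Cocycle.ext (toSingleMk_eq_postcomp φ f hfφ)
  have e₂ := Cocycle.equivHomShift_symm_comp Φ (S.cocycleMk g hg) (R.cocycleMk h hh)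
    (by lia) (toSingleMk_eq_comp φ g h hgh)
  rw [Ext.comp_hom, extMk_hom, extMk_hom, extMk_hom]
  simp only [cocycleMk] at e₁ e₂
  rw [e₁, e₂, Cocycle.equivHomShift_symm_postcomp, ← ShiftedHom.comp_mk₀ _ 0 rfl,
    ShiftedHom.map_comp, ShiftedHom.map_comp, ShiftedHom.map_mk₀,
    ShiftedHom.comp_assoc _ _ (.mk₀ _ _ _) (zero_add _) (zero_add _) (by simp),
    ShiftedHom.mk₀_comp_mk₀]
  -- The augmentation of `S` ending the first class cancels its derived-category inverse, which
  -- begins the second.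
  exact ShiftedHom.mk₀_comp_comp_mk₀ _ _ _ _ _ _ (by simp) _

end CategoryTheory.ProjectiveResolution

/-! ### Vanishing of classes in degree zero -/

namespace CategoryTheory.ProjectiveResolution

open CochainComplex HomComplex Limits

variable {C : Type*} [Category* C] [Abelian C] [HasExt C] {X Y : C} (R : ProjectiveResolution X)

theorem extMk_degree_zero_eq_zero_iff (f : R.complex.X 0 ⟶ Y) (m : ℕ) (hm : 0 + 1 = m)
    (hf : R.complex.d m 0 ≫ f = 0) : R.extMk f m hm hf = 0 ↔ f = 0 := by
  simp only [← R.extEquivCohomologyClass.apply_eq_iff_eq, extEquivCohomologyClass_extMk,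
    extEquivCohomologyClass_zero, CohomologyClass.mk_eq_zero_iff]
  rw [Cocycle.toSingleMk_mem_coboundaries_iff _ _ _ _ _ 1 (by lia)]
  refine ⟨fun ⟨g, hg⟩ => ?_, fun h => ⟨0, by simp [h]⟩⟩
  -- A coboundary in degree zero would factor through the term of cochain degree 1, which is zero.
  rw [(isZero_of_isStrictlyLE R.cochainComplex 0 1 (by lia)).eq_of_src g 0, comp_zero] at hg
  rw [← cancel_epi (R.cochainComplexXIso (-(0 : ℕ)) 0 rfl).hom, ← hg, comp_zero]

end CategoryTheory.ProjectiveResolution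

/-! ### Coordinates on A, and the action of the differential's coefficients -/

namespace QCI

open Hochschild

variable (k : Type u) [Field k]

/-- The right regular representation on row vectors, with respect to the basis `1, x, y, x * y`. -/
noncomputable def rightRep : Alg k →ₐ[k] Matrix (Fin 4) (Fin 4) k :=
  lift k !![0, 1, 0, 0; 0, 0, 0, 0; 0, 0, 0, -1; 0, 0, 0, 0]
    !![0, 0, 1, 0; 0, 0, 0, 1; 0, 0, 0, 0; 0, 0, 0, 0]
    (by ext i j; fin_cases i <;> fin_cases j <;> simp)
    (by ext i j; fin_cases i <;> fin_cases j <;> simp)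
    (by ext i j; fin_cases i <;> fin_cases j <;> simp [Matrix.mul_apply, Fin.sum_univ_four])

/-- The coordinates with respect to the basis `1, x, y, x * y`. -/
noncomputable def coord (i : Fin 4) : Alg k →ₗ[k] k :=
  Matrix.entryLinearMap k k 0 i ∘ₗ (rightRep k).toLinearMap

theorem coord_one (i : Fin 4) : coord k i 1 = if i = 0 then 1 else 0 := by
  simp [coord, Matrix.one_apply, eq_comm]

theorem coord_mul_x (a : Alg k) (i : Fin 4) :
    coord k i (a * x k) = ![0, coord k 0 a, 0, -coord k 2 a] i := by
  fin_cases i <;> simp [coord, rightRep, lift_x, Matrix.mul_apply, Fin.sum_univ_four]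

theorem coord_mul_y (a : Alg k) (i : Fin 4) :
    coord k i (a * y k) = ![0, 0, coord k 0 a, coord k 1 a] i := by
  fin_cases i <;> simp [coord, rightRep, lift_y, Matrix.mul_apply, Fin.sum_univ_four]

theorem coord_x (i : Fin 4) : coord k i (x k) = if i = 1 then 1 else 0 := by
  have h := coord_mul_x k 1 i
  rw [one_mul] at h
  rw [h]
  fin_cases i <;> simp [coord_one]

theorem coord_y (i : Fin 4) : coord k i (y k) = if i = 2 then 1 else 0 := by
  have h := coord_mul_y k 1 i
  rw [one_mul] at h
  rw [h]
  fin_cases i <;> simp [coord_one]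

theorem coord_xy (i : Fin 4) : coord k i (x k * y k) = if i = 3 then 1 else 0 := by
  rw [coord_mul_y]
  fin_cases i <;> simp [coord_x]

theorem x_mul_xy : x k * (x k * y k) = 0 := by rw [← mul_assoc, x_mul_x, zero_mul]
theorem y_mul_xy : y k * (x k * y k) = 0 := by
  rw [← mul_assoc, y_mul_x, neg_mul, mul_assoc, y_mul_y, mul_zero, neg_zero]
theorem xy_mul_x : x k * y k * x k = 0 := by rw [mul_assoc, y_mul_x, mul_neg, x_mul_xy, neg_zero]
theorem xy_mul_y : x k * y k * y k = 0 := by rw [mul_assoc, y_mul_y, mul_zero]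

theorem eq_sum_coord (a : Alg k) :
    a = coord k 0 a • 1 + coord k 1 a • x k + coord k 2 a • y k + coord k 3 a • (x k * y k) := by
  induction a using alg_induction with
  | one => simp [coord_one]
  | add a b ha hb =>
    simp only [map_add, add_smul]
    nth_rw 1 [ha, hb]
    abel
  | smul c a ha =>
    simp only [map_smul, smul_assoc, ← smul_add]
    rw [← ha]
  | mul_x a ha =>
    simp only [coord_mul_x]
    nth_rw 1 [ha]
    simp [add_mul, x_mul_x, y_mul_x, xy_mul_x]
  | mul_y a ha =>
    simp only [coord_mul_y]
    nth_rw 1 [ha]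
    simp [add_mul, y_mul_y, xy_mul_y]

theorem xy_mul_comm (a : Alg k) : x k * y k * a = a * (x k * y k) := by
  rw [eq_sum_coord k a]
  simp [add_mul, mul_add, ← mul_assoc, xy_mul_x, x_mul_x, y_mul_x, mul_assoc _ (y k) (y k),
    y_mul_y]

theorem coord_zero_xy_mul (a : Alg k) : coord k 0 (x k * y k * a) = 0 := by
  rw [xy_mul_comm, ← mul_assoc, coord_mul_y]; rfl

/-- The action is the commutator a ↦ ax - xa. The elements 1, x, xy commute with x, and yx = -xy
doubles the contribution of y. -/
theorem alphaX_smul (a : Alg k) : alphaX k • a = -((2 * coord k 2 a) • (x k * y k)) := by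
  have h : alphaX k • a = a * x k - x k * a := by
    simp [alphaX, sub_smul, xr, xl, smul_alg]
  rw [h]
  nth_rw 1 2 [eq_sum_coord k a]
  simp [add_mul, mul_add, xy_mul_x, x_mul_xy, x_mul_x, y_mul_x, two_mul, add_smul]
  abel

theorem alphaY_smul (a : Alg k) : alphaY k • a = (2 * coord k 1 a) • (x k * y k) := by
  have h : alphaY k • a = a * y k - y k * a := by
    simp [alphaY, sub_smul, yr, yl, smul_alg]
  rw [h]
  nth_rw 1 2 [eq_sum_coord k a]
  simp [add_mul, mul_add, xy_mul_y, y_mul_xy, y_mul_y, y_mul_x, two_mul, add_smul]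

/-- The action is the anticommutator a ↦ ax + xa. It kills x, y and xy, so only the constant term
survives, doubled. -/
theorem betaX_smul (a : Alg k) : betaX k • a = (2 * coord k 0 a) • x k := by
  have h : betaX k • a = a * x k + x k * a := by
    simp [betaX, add_smul, xr, xl, smul_alg]
  rw [h]
  nth_rw 1 2 [eq_sum_coord k a]
  simp [add_mul, mul_add, xy_mul_x, x_mul_xy, x_mul_x, y_mul_x, two_mul, add_smul]
  abel

theorem betaY_smul (a : Alg k) : betaY k • a = (2 * coord k 0 a) • y k := by
  have h : betaY k • a = a * y k + y k * a := by
    simp [betaY, add_smul, yr, yl, smul_alg]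
  rw [h]
  nth_rw 1 2 [eq_sum_coord k a]
  simp [add_mul, mul_add, xy_mul_y, y_mul_xy, y_mul_y, y_mul_x, two_mul, add_smul]
  abel

/-! ### Cochains by their values on generators, and their classes -/

theorem f_eq_zero {n : ℕ} {i : ℤ} (h : ¬ (0 ≤ i ∧ i ≤ n)) : f k n i = 0 := by
  ext j
  have : ¬ ((j : ℕ) : ℤ) = i := by omega
  simp [f, this]

theorem f_coe {n : ℕ} (i : Fin (n + 1)) : f k n (i : ℕ) = Pi.single i 1 := by
  ext j
  simp [f, Pi.single_apply, Fin.ext_iff]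

theorem hom_ext_f {M : Type*} [AddCommGroup M] [Module (Ae k) M] {n : ℕ} {F G : P k n →ₗ[Ae k] M}
    (h : ∀ i : ℤ, F (f k n i) = G (f k n i)) : F = G :=
  LinearMap.pi_ext' fun i => LinearMap.ext_ring (by simpa [f_coe] using h (i : ℕ))

/-- The linear map with prescribed values on the generators. -/
noncomputable def ofValues {M : Type*} [AddCommGroup M] [Module (Ae k) M] (n : ℕ) (v : ℤ → M) :
    P k n →ₗ[Ae k] M :=
  Fintype.linearCombination (Ae k) fun i : Fin (n + 1) => v (i : ℕ)

/-- Requiring `v` to vanish outside the range matches the convention for `f`, so formulas involving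
i and i - 1 need no boundary cases. -/
theorem ofValues_f {M : Type*} [AddCommGroup M] [Module (Ae k) M] {n : ℕ} {v : ℤ → M}
    (hv : ∀ i : ℤ, ¬ (0 ≤ i ∧ i ≤ n) → v i = 0) (i : ℤ) : ofValues k n v (f k n i) = v i := by
  by_cases h : 0 ≤ i ∧ i ≤ n
  · obtain ⟨j, rfl⟩ : ∃ j : Fin (n + 1), i = (j : ℕ) := ⟨⟨i.toNat, by omega⟩, by simp; omega⟩
    simp [ofValues, f_coe, Fintype.linearCombination_apply_single]
  · rw [f_eq_zero k h, map_zero, hv i h]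

theorem d_f {n : ℕ} (i : ℤ) : d k n (f k (n + 1) i) = dGen k n i := by
  refine ofValues_f k (v := dGen k n) (fun i h => ?_) i
  rw [dGen, f_eq_zero k (by omega), f_eq_zero k (by omega)]
  simp

/-- The cohomology class of a cocycle `P n → A`. -/
noncomputable def cls {n : ℕ} (F : P k n →ₗ[Ae k] Alg k) (hF : ∀ z, F (d k n z) = 0) :
    HH k (Alg k) n :=
  (resolution k).extMk (ModuleCat.ofHom F) (n + 1) rfl (by
    change (complex k).d _ _ ≫ _ = 0
    rw [complex_d]
    ext1
    exact LinearMap.ext hF)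

theorem exists_cls {n : ℕ} (α : HH k (Alg k) n) : ∃ F hF, α = cls k (n := n) F hF := by
  obtain ⟨F, hF, rfl⟩ := (resolution k).extMk_surjective α (n + 1) rfl
  have hF' : (complex k).d _ _ ≫ F = 0 := hF
  rw [complex_d] at hF'
  exact ⟨F.hom, fun z => LinearMap.congr_fun (ModuleCat.hom_ext_iff.mp hF') z, rfl⟩

/-- By exactness at `P k 0`, the kernel of the augmentation is the image of the differential, on
which a cocycle vanishes. -/
theorem exists_comp_mu (F : P k 0 →ₗ[Ae k] Alg k) (hF : ∀ z, F (d k 0 z) = 0) :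
    ∃ g : Alg k →ₗ[Ae k] Alg k, F = g ∘ₗ mu k := by
  have h : LinearMap.ker (mu k) ≤ LinearMap.ker F := fun z hz => by
    obtain ⟨u, rfl⟩ := exact_zero k z hz
    exact hF u
  refine ⟨(LinearMap.ker (mu k)).liftQ F h ∘ₗ
    ((mu k).quotKerEquivOfSurjective (mu_surjective k)).symm.toLinearMap, LinearMap.ext fun z => ?_⟩
  have e : ((mu k).quotKerEquivOfSurjective (mu_surjective k)).symm (mu k z) =
      Submodule.Quotient.mk z := by
    rw [LinearEquiv.symm_apply_eq]
    rfl
  simp only [LinearMap.comp_apply, LinearEquiv.coe_coe, e]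
  rfl

theorem cls_add {n : ℕ} (F G : P k n →ₗ[Ae k] Alg k) (hF hG) (h) :
    cls k (F + G) h = cls k F hF + cls k G hG :=
  ((resolution k).add_extMk _ _ _ _ _ _).symm

theorem cls_sub {n : ℕ} (F G : P k n →ₗ[Ae k] Alg k) (hF hG) (h) :
    cls k (F - G) h = cls k F hF - cls k G hG :=
  ((resolution k).sub_extMk _ _ _ _ _ _).symm

/-- Postcomposition with an endomorphism of the bimodule. -/
theorem cls_comp_mk₀ {n : ℕ} (F : P k n →ₗ[Ae k] Alg k) (hF) (g : Alg k →ₗ[Ae k] Alg k) (h) :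
    (cls k F hF).comp (Ext.mk₀ (ModuleCat.ofHom g)) (add_zero n) = cls k (g ∘ₗ F) h :=
  (resolution k).extMk_comp_mk₀ _ _ _ _ _

theorem ae_zero_smul (a : Alg k) : (0 : Ae k) • a = 0 := zero_smul (Ae k) a

theorem neg_one_pow_smul (j : ℕ) (a : Alg k) : (-1 : Ae k) ^ j • a = (-1 : k) ^ j • a := by
  rcases Nat.even_or_odd j with h | h
  · have h' : (-1 : Ae k) ^ j = 1 := @Even.neg_one_pow (Ae k) _ _ _ h
    rw [h', h.neg_one_pow, one_smul, one_smul]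
  · have h' : (-1 : Ae k) ^ j = -1 := @Odd.neg_one_pow (Ae k) _ _ _ h
    rw [h', h.neg_one_pow, neg_smul, neg_smul, one_smul, one_smul]

theorem map_dGen_of_even {n : ℕ} (hn : Even (n + 1)) (F : P k n →ₗ[Ae k] Alg k) (i : ℤ) :
    F (dGen k n i) = (-1 : k) ^ i.natAbs • ((2 * coord k 0 (F (f k n i))) • y k +
      (2 * coord k 0 (F (f k n (i - 1)))) • x k) := by
  rw [dGen, if_pos hn, F.map_smul, F.map_add, F.map_smul, F.map_smul, neg_one_pow_smul,
    betaX_smul, betaY_smul]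

theorem map_dGen_of_odd {n : ℕ} (hn : Even n) (F : P k n →ₗ[Ae k] Alg k) (i : ℤ) :
    F (dGen k n i) = ((-1 : k) ^ i.natAbs * 2 * (coord k 1 (F (f k n i)) +
      coord k 2 (F (f k n (i - 1))))) • (x k * y k) := by
  rw [dGen, if_neg (by simpa [Nat.even_add_one] using hn), F.map_smul, F.map_sub, F.map_smul,
    F.map_smul, neg_one_pow_smul, alphaX_smul, alphaY_smul, sub_neg_eq_add, ← add_smul, smul_smul]
  ring_nf

/-- Multiplication by a scalar as an endomorphism of the bimodule. -/
noncomputable def scalar (c : k) : Alg k →ₗ[Ae k] Alg k where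
  toFun a := c • a
  map_add' := smul_add c
  map_smul' z a := by
    rw [RingHom.id_apply]
    induction z using TensorProduct.induction_on with
    | zero => rw [ae_zero_smul, ae_zero_smul, smul_zero]
    | tmul u v => simp [smul_alg]
    | add u v hu hv => rw [add_smul, smul_add, hu, hv, add_smul]

theorem scalar_apply (c : k) (a : Alg k) : scalar k c a = c • a := rfl

theorem cls_smul {n : ℕ} (c : k) (F : P k n →ₗ[Ae k] Alg k) (hF) (h) :
    cls k (scalar k c ∘ₗ F) h = c • cls k F hF := by
  rw [Ext.smul_eq_comp_mk₀, ← cls_comp_mk₀ k F hF]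
  congr 2
  ext a
  change c • a = algebraMap k (Ae k) c • a
  rw [Algebra.TensorProduct.algebraMap_apply, smul_alg]
  simp [Algebra.smul_def]

/-! ### Coboundaries and constant terms -/

theorem cls_eq_zero_iff {n : ℕ} (F : P k (n + 1) →ₗ[Ae k] Alg k) (hF) :
    cls k F hF = 0 ↔ ∃ G : P k n →ₗ[Ae k] Alg k, G ∘ₗ d k n = F := by
  refine ((resolution k).extMk_eq_zero_iff _ _ _ _ n rfl).trans ?_
  constructor
  · rintro ⟨G, hG⟩
    have hG' : (complex k).d _ _ ≫ G = _ := hG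
    rw [complex_d] at hG'
    exact ⟨G.hom, ModuleCat.hom_ext_iff.mp hG'⟩
  · rintro ⟨G, hG⟩
    refine ⟨ModuleCat.ofHom G, ?_⟩
    change (complex k).d _ _ ≫ _ = _
    rw [complex_d, ← hG]
    rfl

/-- A coboundary in positive even degree takes values in the span of x and y on generators; in
degree zero there are no nonzero coboundaries. Constant terms are therefore invariants of the class.
-/
theorem coord_zero_of_cls_eq_zero {n : ℕ} (hn : Even n) (F : P k n →ₗ[Ae k] Alg k) (hF)
    (h : cls k F hF = 0) (i : ℤ) : coord k 0 (F (f k n i)) = 0 := by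
  cases n with
  | zero =>
    have := ((resolution k).extMk_degree_zero_eq_zero_iff _ _ _ _).mp h
    have : F = 0 := ModuleCat.hom_ext_iff.mp this
    simp [this]
  | succ n =>
    obtain ⟨G, rfl⟩ := (cls_eq_zero_iff k F hF).mp h
    rw [LinearMap.comp_apply, d_f, map_dGen_of_even k hn]
    simp [coord_x, coord_y]

/-- The `r`-th coefficient of a cohomology class of even degree: the constant term of the value of a
representing cocycle on the generator `f n r`. -/
noncomputable def coefFun (t : ℕ) (r : ℤ) (α : HH k (Alg k) (2 * t)) : k :=
  coord k 0 ((exists_cls k α).choose (f k (2 * t) r))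

theorem coefFun_cls (t : ℕ) (r : ℤ) (F : P k (2 * t) →ₗ[Ae k] Alg k) (hF) :
    coefFun k t r (cls k F hF) = coord k 0 (F (f k (2 * t) r)) := by
  obtain ⟨hG, e⟩ := (exists_cls k (cls k F hF)).choose_spec
  rw [coefFun, ← sub_eq_zero, ← map_sub, ← LinearMap.sub_apply]
  refine coord_zero_of_cls_eq_zero k (even_two_mul t) _ (fun z => ?_) ?_ r
  · rw [LinearMap.sub_apply, hF, hG, sub_zero]
  · rw [cls_sub k _ _ hG hF, ← e, sub_self]

/-- `coefFun` as a linear map. -/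
noncomputable def coef (t : ℕ) (r : ℤ) : HH k (Alg k) (2 * t) →ₗ[k] k where
  toFun := coefFun k t r
  map_add' α β := by
    obtain ⟨F, hF, rfl⟩ := exists_cls k α
    obtain ⟨G, hG, rfl⟩ := exists_cls k β
    rw [← cls_add k F G hF hG (fun z => by simp [hF, hG])]
    simp only [coefFun_cls, LinearMap.add_apply, map_add]
  map_smul' c α := by
    obtain ⟨F, hF, rfl⟩ := exists_cls k α
    rw [← cls_smul k c F hF (fun z => by simp [hF])]
    simp only [coefFun_cls, LinearMap.comp_apply, scalar_apply, map_smul, RingHom.id_apply]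

theorem coef_cls (t : ℕ) (r : ℤ) (F : P k (2 * t) →ₗ[Ae k] Alg k) (hF) :
    coef k t r (cls k F hF) = coord k 0 (F (f k (2 * t) r)) :=
  coefFun_cls k t r F hF

theorem xi_eq_cls (t : ℕ) (r : Fin (2 * t + 1)) :
    xi k t r = cls k (xiMap k (2 * t) r) (xiMap_d k t r) := rfl

theorem xiMap_f {n : ℕ} (r : Fin (n + 1)) (i : ℤ) :
    xiMap k n r (f k n i) = if i = (r : ℕ) then 1 else 0 := by
  rw [xiMap_apply, f]
  by_cases h : i = (r : ℕ)
  · simp [h]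
  · rw [if_neg (Ne.symm h), if_neg h, ae_zero_smul]

theorem coef_xi (t : ℕ) (r : Fin (2 * t + 1)) (i : ℤ) :
    coef k t i (xi k t r) = if i = (r : ℕ) then 1 else 0 := by
  rw [xi_eq_cls, coef_cls, xiMap_f]
  split_ifs <;> simp [coord_one]

/-! ### The central class of xy -/

/-- Multiplication by the central element `x * y` as an endomorphism of the bimodule. -/
noncomputable def xyMul : Alg k →ₗ[Ae k] Alg k where
  toFun a := x k * y k * a
  map_add' := mul_add _
  map_smul' z a := by
    rw [RingHom.id_apply]
    induction z using TensorProduct.induction_on with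
    | zero => rw [ae_zero_smul, ae_zero_smul, mul_zero]
    | tmul u v =>
      rw [smul_alg, smul_alg, ← mul_assoc, xy_mul_comm, mul_assoc, mul_assoc (x k * y k)]
    | add u v hu hv => rw [add_smul, mul_add, hu, hv, add_smul]

theorem xyMul_apply (a : Alg k) : xyMul k a = x k * y k * a := rfl

/-- The class of `x * y` in degree zero. -/
noncomputable def zeta : HH k (Alg k) 0 := Ext.mk₀ (ModuleCat.ofHom (xyMul k))

theorem cls_comp_zeta {n : ℕ} (F : P k n →ₗ[Ae k] Alg k) (hF) :
    (cls k F hF).comp (zeta k) (add_zero n) = cls k (xyMul k ∘ₗ F) (fun z => by simp [hF]) :=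
  cls_comp_mk₀ k F hF _ _

theorem coef_comp_zeta (t : ℕ) (r : ℤ) (α : HH k (Alg k) (2 * t)) :
    coef k t r (α.comp (zeta k) (add_zero _)) = 0 := by
  obtain ⟨F, hF, rfl⟩ := exists_cls k α
  rw [cls_comp_zeta, coef_cls, LinearMap.comp_apply, xyMul_apply, coord_zero_xy_mul]

theorem zeta_comp_zeta : (zeta k).comp (zeta k) (add_zero 0) = 0 := by
  have h : xyMul k ∘ₗ xyMul k = 0 := by
    ext a
    simp [xyMul_apply, ← mul_assoc, xy_mul_x]
  rw [zeta, Ext.mk₀_comp_mk₀, ← ModuleCat.ofHom_comp, h]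
  exact Ext.mk₀_zero _ _

/-- Multiplication by `x * y` on the resolution. -/
noncomputable def xyRight (n : ℕ) : P k n →ₗ[Ae k] P k n :=
  LinearMap.pi fun j => LinearMap.toSpanSingleton (Ae k) (Ae k) (xl k * yl k) ∘ₗ LinearMap.proj j

theorem xyRight_apply (n : ℕ) (z : P k n) (j : Fin (n + 1)) :
    xyRight k n z j = z j * (xl k * yl k) := rfl

/-- Centrality of xy in A makes xy ⊗ 1 central in the enveloping algebra, so multiplication by it is
linear on each term of the resolution and commutes with the differentials. -/
theorem xlyl_comm (a : Ae k) : xl k * yl k * a = a * (xl k * yl k) := by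
  induction a using TensorProduct.induction_on with
  | zero => simp
  | tmul u v => simp [xl, yl, xy_mul_comm]
  | add u v hu hv => rw [mul_add, add_mul, hu, hv]

theorem xyRight_d (n : ℕ) (z : P k (n + 1)) :
    xyRight k n (d k n z) = d k n (xyRight k (n + 1) z) := by
  ext j
  rw [d_apply, xyRight_apply, d_apply, xyRight_apply, xyRight_apply, ← xlyl_comm, mul_add]
  simp only [← mul_assoc, xlyl_comm]

/-- Multiplication by `x * y` as an endomorphism of the resolution. -/
noncomputable def xyHom : ProjectiveResolution.Hom (resolution k) (resolution k)
    (ModuleCat.ofHom (xyMul k)) where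
  hom := ChainComplex.ofHom (X := complex k) (Y := complex k)
    (fun n => ModuleCat.ofHom (xyRight k n)) (fun n => by
      rw [complex_d]
      exact congrArg ModuleCat.ofHom
        (LinearMap.ext fun z => (xyRight_d k n z).symm :
          d k n ∘ₗ xyRight k (n + 1) = xyRight k n ∘ₗ d k n))
  hom_f_zero_comp_π_f_zero := by
    change ModuleCat.ofHom (xyRight k 0) ≫ ModuleCat.ofHom (mu k) =
      ModuleCat.ofHom (mu k) ≫ ModuleCat.ofHom (xyMul k)
    refine congrArg ModuleCat.ofHom (LinearMap.ext fun z => ?_ :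
      mu k ∘ₗ xyRight k 0 = xyMul k ∘ₗ mu k)
    rw [LinearMap.comp_apply, LinearMap.comp_apply]
    rw [mu_apply, mu_apply, map_smul, xyRight_apply, mul_smul]
    simp [xl, yl, xyMul_apply, smul_alg]

/-- Multiplication by xy lifts to the resolution as the action of the central element xy ⊗ 1. By
linearity a cocycle turns this into multiplication by xy on its values, which is composition with
`zeta` on the other side. -/
theorem zeta_comp {n : ℕ} (α : HH k (Alg k) n) :
    (zeta k).comp α (zero_add n) = α.comp (zeta k) (add_zero n) := by
  obtain ⟨F, hF, rfl⟩ := exists_cls k α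
  have h : F ∘ₗ xyRight k n = xyMul k ∘ₗ F := by
    refine LinearMap.ext fun z => ?_
    have e : xyRight k n z = (xl k * yl k) • z := funext fun j => (xlyl_comm k (z j)).symm
    rw [LinearMap.comp_apply, e, F.map_smul]
    simp [xl, yl, smul_alg, xyMul_apply]
  have h' : (xyHom k).hom.f n ≫ ModuleCat.ofHom F = ModuleCat.ofHom (xyMul k ∘ₗ F) := by
    rw [← h]
    rfl
  rw [cls_comp_zeta, cls, cls, zeta]
  simp only [← h']
  exact ProjectiveResolution.mk₀_comp_extMk _ _ rfl _ (xyHom k)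

/-! ### Computation of the even cohomology groups -/

theorem cocycle_of_coord {n : ℕ} (hn : Even n) (F : P k n →ₗ[Ae k] Alg k)
    (h : ∀ i, coord k 1 (F (f k n i)) + coord k 2 (F (f k n (i - 1))) = 0) (z : P k (n + 1)) :
    F (d k n z) = 0 := by
  have : F ∘ₗ d k n = 0 := hom_ext_f k fun i => by
    rw [LinearMap.comp_apply, d_f, map_dGen_of_odd k hn, h, mul_zero, zero_smul,
      LinearMap.zero_apply]
  exact LinearMap.congr_fun this z

/-- The values of the coboundary are ±2 times this sum, times xy; invertibility of 2 lets the factor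
be cancelled. -/
theorem coord_of_cocycle (hk : (2 : k) ≠ 0) {n : ℕ} (hn : Even n) (F : P k n →ₗ[Ae k] Alg k)
    (hF : ∀ z, F (d k n z) = 0) (i : ℤ) :
    coord k 1 (F (f k n i)) + coord k 2 (F (f k n (i - 1))) = 0 := by
  have h := congrArg (coord k 3) (hF (f k (n + 1) i))
  rw [d_f, map_dGen_of_odd k hn, map_smul, coord_xy, if_pos rfl, map_zero] at h
  simpa [hk] using h

/-- The cocycle condition ties the x-coefficient at i to the y-coefficient at i - 1, so the
y-coefficients determine the cocycle. In degree zero they vanish; in higher degree, half of them,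
with signs, define a scalar cochain that bounds it. -/
theorem cls_eq_zero_of_coord (hk : (2 : k) ≠ 0) {n : ℕ} (hn : Even n) (F : P k n →ₗ[Ae k] Alg k)
    (hF) (h₀ : ∀ i, coord k 0 (F (f k n i)) = 0) (h₃ : ∀ i, coord k 3 (F (f k n i)) = 0) :
    cls k F hF = 0 := by
  have h₁₂ := coord_of_cocycle k hk hn F hF
  have hv (i : ℤ) : F (f k n i) = coord k 1 (F (f k n i)) • x k + coord k 2 (F (f k n i)) • y k := by
    nth_rw 1 [eq_sum_coord k (F (f k n i))]
    simp [h₀, h₃]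
  cases n with
  | zero =>
    have : F = 0 := hom_ext_f k fun i => by
      have h1 := h₁₂ i
      have h2 := h₁₂ (i + 1)
      rw [add_sub_cancel_right] at h2
      rw [hv]
      by_cases hi : i = 0
      · rw [f_eq_zero k (i := i - 1) (by omega), map_zero, map_zero, add_zero] at h1
        rw [f_eq_zero k (i := i + 1) (by omega), map_zero, map_zero, zero_add] at h2
        simp [h1, h2]
      · rw [f_eq_zero k (by omega)]
        simp
    subst this
    exact ProjectiveResolution.extMk_zero _ _ _
  | succ n =>
    refine (cls_eq_zero_iff k F hF).mpr
      -- The differential multiplies a scalar at index i by (-1)^i · 2y. Dividing by that factor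
      -- recovers the y-part, and the sign change from i to i - 1 then produces the x-part.
      ⟨ofValues k n fun i => ((-1) ^ i.natAbs * coord k 2 (F (f k (n + 1) i)) / 2) • 1, ?_⟩
    refine hom_ext_f k fun i => ?_
    have hs : (-1 : k) ^ (i - 1).natAbs = -(-1) ^ i.natAbs := by
      rw [neg_one_pow_congr (n := i.natAbs + 1) (by grind), pow_succ, mul_neg_one]
    have hs' : (-1 : k) ^ i.natAbs * (-1) ^ i.natAbs = 1 := by
      rw [← pow_add, Even.neg_one_pow ⟨_, rfl⟩]
    -- The index n + 1 exists in `P k (n + 1)` but not in `P k n`. The y-coefficient there vanishes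
    -- by the cocycle condition at n + 2, where the generator is zero.
    have hv₂ (j : ℤ) (hj : ¬ (0 ≤ j ∧ j ≤ n)) :
        ((-1) ^ j.natAbs * coord k 2 (F (f k (n + 1) j)) / 2) • (1 : Alg k) = 0 := by
      have h : coord k 2 (F (f k (n + 1) j)) = 0 := by
        by_cases hj' : j < 0
        · rw [f_eq_zero k (by omega), map_zero, map_zero]
        · have h1 := h₁₂ (j + 1)
          rwa [f_eq_zero k (i := j + 1) (by omega), map_zero, map_zero, zero_add,
            add_sub_cancel_right] at h1
      rw [h, mul_zero, zero_div, zero_smul]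
    have e (a : k) : 2 * (a / 2) = a := by field_simp
    refine Eq.trans ?_ (hv i).symm
    rw [LinearMap.comp_apply, d_f, map_dGen_of_even k hn, ofValues_f k hv₂, ofValues_f k hv₂,
      add_comm (coord k 1 (F (f k (n + 1) i)) • x k), eq_neg_of_add_eq_zero_left (h₁₂ i)]
    simp only [map_smul, coord_one, hs, smul_add, smul_smul, smul_eq_mul, mul_one, if_true, e]
    rw [← mul_assoc, ← mul_assoc, mul_neg, hs', one_mul, neg_one_mul]

theorem cls_sum {ι : Type*} (s : Finset ι) {n : ℕ} (F : ι → P k n →ₗ[Ae k] Alg k)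
    (hF : ∀ i z, F i (d k n z) = 0) (h) :
    cls k (∑ i ∈ s, F i) h = ∑ i ∈ s, cls k (F i) (hF i) := by
  classical
  induction s using Finset.induction_on with
  | empty => exact ProjectiveResolution.extMk_zero _ _ _
  | insert a s ha ih =>
    simp only [Finset.sum_insert ha]
    rw [cls_add k _ _ (hF a) (fun z => by simp [LinearMap.sum_apply, hF]), ih]

/-- Scalar cochains are cocycles in even degree. Removing the scalar part, and xy times another
scalar cochain, leaves a cocycle with neither constant nor xy terms, whose class is zero. -/
theorem eq_sum_xi_add (hk : (2 : k) ≠ 0) (t : ℕ) (α : HH k (Alg k) (2 * t)) :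
    ∃ β : HH k (Alg k) (2 * t), α = ∑ r : Fin (2 * t + 1), coef k t (r : ℕ) α • xi k t r +
      β.comp (zeta k) (add_zero _) := by
  obtain ⟨F, hF, rfl⟩ := exists_cls k α
  have hv (i : ℤ) (hi : ¬ (0 ≤ i ∧ i ≤ (2 * t : ℕ))) :
      coord k 3 (F (f k (2 * t) i)) • (1 : Alg k) = 0 := by simp [f_eq_zero k hi]
  set B := ofValues k (2 * t) fun i => coord k 3 (F (f k (2 * t) i)) • (1 : Alg k)
  have hB : ∀ z, B (d k (2 * t) z) = 0 := cocycle_of_coord k (even_two_mul t) _ fun i => by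
    rw [ofValues_f k hv, ofValues_f k hv]
    simp [coord_one]
  have hS (r : Fin (2 * t + 1)) (z : P k (2 * t + 1)) :
      (scalar k (coord k 0 (F (f k (2 * t) (r : ℕ)))) ∘ₗ xiMap k (2 * t) r) (d k (2 * t) z) = 0 := by
    simp [xiMap_d]
  have hSf (i : ℤ) :
      (∑ r : Fin (2 * t + 1), scalar k (coord k 0 (F (f k (2 * t) (r : ℕ)))) ∘ₗ xiMap k (2 * t) r)
        (f k (2 * t) i) = coord k 0 (F (f k (2 * t) i)) • 1 := by
    simp only [LinearMap.sum_apply, LinearMap.comp_apply, xiMap_f, scalar_apply]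
    by_cases hi : 0 ≤ i ∧ i ≤ (2 * t : ℕ)
    · rw [Fintype.sum_eq_single ⟨i.toNat, by omega⟩]
      · simp [hi.1]
      · intro r hr
        rw [if_neg (fun h => hr (Fin.ext (by simp [h]))), smul_zero]
    · rw [f_eq_zero k hi]
      refine (Finset.sum_eq_zero fun r _ => ?_).trans (by simp)
      rw [if_neg (by omega), smul_zero]
  have hS' (z : P k (2 * t + 1)) :
      (∑ r : Fin (2 * t + 1), scalar k (coord k 0 (F (f k (2 * t) (r : ℕ)))) ∘ₗ xiMap k (2 * t) r)
        (d k (2 * t) z) = 0 := by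
    rw [LinearMap.sum_apply]
    exact Finset.sum_eq_zero fun r _ => hS r z
  have hB' (z : P k (2 * t + 1)) : (xyMul k ∘ₗ B) (d k (2 * t) z) = 0 := by simp [hB]
  refine ⟨cls k B hB, ?_⟩
  simp only [coef_cls, xi_eq_cls, ← cls_smul k _ _ _ (hS _)]
  rw [← cls_sum k _ _ hS hS', cls_comp_zeta,
    ← cls_add k _ _ hS' hB' (fun z => by rw [LinearMap.add_apply, hS', hB', add_zero]),
    ← sub_eq_zero,
    ← cls_sub k _ _ hF _ (fun z => by
      rw [LinearMap.sub_apply, LinearMap.add_apply, hS', hB', hF, add_zero, sub_zero])]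
  have hv' (i : ℤ) : (F - (∑ r : Fin (2 * t + 1), scalar k (coord k 0 (F (f k (2 * t) (r : ℕ)))) ∘ₗ
      xiMap k (2 * t) r + xyMul k ∘ₗ B)) (f k (2 * t) i) = F (f k (2 * t) i) -
        (coord k 0 (F (f k (2 * t) i)) • 1 + coord k 3 (F (f k (2 * t) i)) • (x k * y k)) := by
    rw [LinearMap.sub_apply, LinearMap.add_apply, hSf, LinearMap.comp_apply, ofValues_f k hv,
      xyMul_apply, mul_smul_comm, mul_one]
  refine cls_eq_zero_of_coord k hk (even_two_mul t) _ _ (fun i => ?_) (fun i => ?_) <;>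
  · rw [hv']
    simp [coord_one, coord_xy]

/-! ### Index-shifting chain maps and products of the generators -/

theorem ae_neg_one_pow_congr {a b : ℕ} (h : Even a ↔ Even b) : (-1 : Ae k) ^ a = (-1) ^ b :=
  @neg_one_pow_congr (Ae k) _ _ _ _ h

/-- The chain map `P (m + j) → P j` lifting `xiMap k m q`, for even `m`. -/
noncomputable def shiftMap (m q j : ℕ) : P k (m + j) →ₗ[Ae k] P k j :=
  ofValues k (m + j) fun i => (-1 : Ae k) ^ (q * j) • f k j (i - q)

variable {k} in
theorem shiftMap_f {m q : ℕ} (hq : q ≤ m) (j : ℕ) (i : ℤ) :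
    shiftMap k m q j (f k (m + j) i) = (-1 : Ae k) ^ (q * j) • f k j (i - q) :=
  ofValues_f k (v := fun i => (-1 : Ae k) ^ (q * j) • f k j (i - q))
    (fun i hi => by rw [f_eq_zero k (by omega), smul_zero]) i

theorem smul_neg_one_pow_smul {n : ℕ} (a : Ae k) (m : ℕ) (v : P k n) :
    a • (-1 : Ae k) ^ m • v = (-1 : Ae k) ^ m • a • v := by
  rw [smul_smul, neg_one_pow_comm, mul_smul]

theorem ae_smul_sub {n : ℕ} (a : Ae k) (u v : P k n) : a • u - a • v = a • (u - v) :=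
  (smul_sub a u v).symm

/-- Evenness of m makes the differentials on both sides of the same type, commutator or
anticommutator. Their signs (-1)^i and (-1)^(i-q) differ by (-1)^q, which raises (-1)^(qj) to
(-1)^(q(j+1)). -/
theorem shiftMap_dGen {m q : ℕ} (hm : Even m) (hq : q ≤ m) (j : ℕ) (i : ℤ) :
    shiftMap k m q j (dGen k (m + j) i) = (-1 : Ae k) ^ (q * (j + 1)) • dGen k j (i - q) := by
  have hp : Even (m + j + 1) ↔ Even (j + 1) := by grind
  have hs : (-1 : Ae k) ^ (i.natAbs + q * j) = (-1) ^ (q * (j + 1) + (i - q).natAbs) :=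
    ae_neg_one_pow_congr k (by
      rw [mul_add]
      generalize q * j = a
      grind)
  have hi : i - 1 - q = i - q - 1 := by ring
  simp only [dGen, hp]
  split_ifs
  all_goals
    simp only [map_smul, map_add, map_sub, shiftMap_f hq, hi]
    simp only [smul_neg_one_pow_smul k (betaX k), smul_neg_one_pow_smul k (betaY k),
      smul_neg_one_pow_smul k (alphaX k), smul_neg_one_pow_smul k (alphaY k), ← smul_add,
      ae_smul_sub]
    rw [smul_smul, smul_smul, ← pow_add, ← pow_add, hs]

theorem shiftMap_d {m q : ℕ} (hm : Even m) (hq : q ≤ m) (j : ℕ) :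
    shiftMap k m q j ∘ₗ d k (m + j) = d k j ∘ₗ shiftMap k m q (j + 1) :=
  hom_ext_f k fun i => by
    have e := shiftMap_f (k := k) hq (j + 1) i
    refine Eq.trans ?_ (congrArg (d k j) e).symm
    rw [LinearMap.comp_apply, d_f, shiftMap_dGen k hm hq, map_smul, d_f]

/-- The total degree `p` and index `s` are separate variables so that 2s + 2t and 2(s + t) can be
matched without transport. -/
theorem xi_comp_xi {m n p : ℕ} (hm : Even m) (hn : Even n) (hp : m + n = p) (q : Fin (m + 1))
    (r : Fin (n + 1)) (s : Fin (p + 1)) (hs : (q : ℕ) + r = s) (hq hr hs') :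
    (cls k (xiMap k m q) hq).comp (cls k (xiMap k n r) hr) hp = cls k (xiMap k p s) hs' := by
  subst hp
  have hqm : (q : ℕ) ≤ m := by omega
  refine ProjectiveResolution.extMk_comp_extMk _ _ hm
    (fun j => ModuleCat.ofHom (shiftMap k m q j)) (fun j => ?_) _ _ ?_ _ _ _ _ ?_
  · change (complex k).d (m + j + 1) (m + j) ≫ _ = _ ≫ (complex k).d (j + 1) j
    rw [complex_d, complex_d]
    exact congrArg ModuleCat.ofHom (shiftMap_d k hm hqm j)
  · refine congrArg ModuleCat.ofHom (hom_ext_f k fun i => ?_ : _ = mu k ∘ₗ shiftMap k m q 0)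
    refine Eq.trans ?_ (congrArg (mu k) (shiftMap_f (k := k) hqm 0 i)).symm
    refine (xiMap_f k q i).trans ?_
    rw [mul_zero, pow_zero, one_smul, mu_apply, f, Fin.val_zero, Nat.cast_zero]
    by_cases h : i = (q : ℕ)
    · simp [h]
    · rw [if_neg h, if_neg (by omega), ae_zero_smul]
  · refine congrArg ModuleCat.ofHom (hom_ext_f k fun i => ?_ :
      _ = xiMap k n r ∘ₗ shiftMap k m q n)
    -- The sign (-1)^(qn) of the lift disappears because n is even.
    rw [LinearMap.comp_apply, shiftMap_f hqm, map_smul, xiMap_f, xiMap_f,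
      show (-1 : Ae k) ^ (q * n : ℕ) = 1 from
        @Even.neg_one_pow (Ae k) _ _ _ (hn.mul_left _), one_smul]
    exact if_congr (by omega) rfl rfl

/-! ### Ring structure: R plus the multiples of `zetaOf` -/

/-- The class `xi k t r` in the even Hochschild cohomology ring. -/
noncomputable def xiOf (t : ℕ) (r : Fin (2 * t + 1)) : HHEvenRing k (Alg k) :=
  DirectSum.of (HHEven k (Alg k)) t (xi k t r)

/-- The class `zeta k` in the even Hochschild cohomology ring. -/
noncomputable def zetaOf : HHEvenRing k (Alg k) :=
  DirectSum.of (HHEven k (Alg k)) 0 (zeta k)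

theorem of_mul_of_zero (t : ℕ) (α : HH k (Alg k) (2 * t)) (β : HH k (Alg k) 0) :
    DirectSum.of (HHEven k (Alg k)) t α * DirectSum.of (HHEven k (Alg k)) 0 β =
      DirectSum.of (HHEven k (Alg k)) t (α.comp β (add_zero _)) :=
  DirectSum.of_mul_of _ _

theorem of_mul_zetaOf (t : ℕ) (α : HH k (Alg k) (2 * t)) :
    DirectSum.of (HHEven k (Alg k)) t α * zetaOf k =
      DirectSum.of (HHEven k (Alg k)) t (α.comp (zeta k) (add_zero _)) :=
  of_mul_of_zero k t α (zeta k)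

theorem zetaOf_comm (h : HHEvenRing k (Alg k)) : zetaOf k * h = h * zetaOf k := by
  have aux {s t : ℕ} (hst : s = t) (α : HH k (Alg k) (2 * t)) (h) :
      DirectSum.of (HHEven k (Alg k)) s ((zeta k).comp α h) =
        DirectSum.of (HHEven k (Alg k)) t (α.comp (zeta k) (add_zero _)) := by
    subst hst
    rw [zeta_comp]
  induction h using DirectSum.induction_on with
  | zero => rw [mul_zero, zero_mul]
  | of t α =>
    rw [of_mul_zetaOf]
    exact (DirectSum.of_mul_of _ _).trans (aux (zero_add t) α _)
  | add a b ha hb => rw [mul_add, add_mul, ha, hb]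

theorem zetaOf_mul_zetaOf : zetaOf k * zetaOf k = 0 := by
  refine (of_mul_zetaOf k 0 (zeta k)).trans ?_
  rw [zeta_comp_zeta, map_zero]

theorem mul_zetaOf_mul_mul_zetaOf (a b : HHEvenRing k (Alg k)) :
    a * zetaOf k * (b * zetaOf k) = 0 := by
  rw [mul_assoc, ← mul_assoc (zetaOf k), zetaOf_comm, mul_assoc b, zetaOf_mul_zetaOf, mul_zero,
    mul_zero]

theorem xiOf_mul_xiOf {s t : ℕ} (q : Fin (2 * s + 1)) (r : Fin (2 * t + 1)) :
    xiOf k s q * xiOf k t r = xiOf k (s + t) ⟨q + r, by omega⟩ :=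
  (DirectSum.of_mul_of _ _).trans (congrArg _ (xi_comp_xi k (even_two_mul s) (even_two_mul t)
    (Nat.mul_add 2 s t).symm q r _ rfl (xiMap_d k s q)
    (xiMap_d k t r) (xiMap_d k (s + t) _)))

/-- Any degree-zero cocycle factors through the augmentation, so 1 = ξ·g with ξ = `xiOf k 0 0`. As ξ
is idempotent, ξ = ξ·1 = ξ·ξ·g = ξ·g = 1. -/
theorem one_eq_xiOf : (1 : HHEvenRing k (Alg k)) = xiOf k 0 0 := by
  obtain ⟨F, hF, h⟩ := exists_cls k (Ext.mk₀ (𝟙 (bimodule k (Alg k))))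
  obtain ⟨g, hg⟩ := exists_comp_mu k F hF
  have hmu : mu k = xiMap k 0 0 := LinearMap.ext fun z => by rw [mu_apply, xiMap_apply]
  have h1 : (1 : HHEvenRing k (Alg k)) =
      xiOf k 0 0 * DirectSum.of (HHEven k (Alg k)) 0 (Ext.mk₀ (ModuleCat.ofHom g)) := by
    refine Eq.trans (congrArg (DirectSum.of (HHEven k (Alg k)) 0) ?_)
      (of_mul_of_zero k 0 (xi k 0 0) (Ext.mk₀ (ModuleCat.ofHom g))).symm
    subst hg
    simp only [hmu] at h
    exact h.trans (cls_comp_mk₀ k (xiMap k 0 0) (xiMap_d k 0 0) g _).symm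
  have h2 : xiOf k 0 0 * xiOf k 0 0 = xiOf k 0 0 := xiOf_mul_xiOf k (s := 0) (t := 0) 0 0
  rw [← mul_one (xiOf k 0 0), h1, ← mul_assoc, h2]

/-- The generators contain 1 and are closed under products, so their linear span is already the
subalgebra. -/
theorem toSubmodule_R : Subalgebra.toSubmodule (R k) =
    Submodule.span k {z | ∃ (t : ℕ) (r : Fin (2 * t + 1)), z = xiOf k t r} := by
  refine (Algebra.adjoin_eq_span _ _).trans (congrArg _ (Set.Subset.antisymm (fun z hz => ?_)
    Submonoid.subset_closure))
  induction hz using Submonoid.closure_induction with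
  | mem z hz => exact hz
  | one => exact ⟨0, 0, one_eq_xiOf k⟩
  | mul y z _ _ hy hz =>
    obtain ⟨s, q, rfl⟩ := hy
    obtain ⟨t, r, rfl⟩ := hz
    exact ⟨s + t, _, xiOf_mul_xiOf k q r⟩

theorem xiOf_mem_R (t : ℕ) (r : Fin (2 * t + 1)) : xiOf k t r ∈ R k :=
  Algebra.subset_adjoin ⟨t, r, rfl⟩

theorem exists_eq_add_mul_zetaOf (hk : (2 : k) ≠ 0) (h : HHEvenRing k (Alg k)) :
    ∃ s ∈ R k, ∃ h', h = s + h' * zetaOf k := by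
  induction h using DirectSum.induction_on with
  | zero => exact ⟨0, zero_mem _, 0, by simp⟩
  | of t α =>
    obtain ⟨β, hβ⟩ := eq_sum_xi_add k hk t α
    refine ⟨∑ r : Fin (2 * t + 1), coef k t (r : ℕ) α • xiOf k t r,
      sum_mem fun r _ => (R k).smul_mem (xiOf_mem_R k t r) _,
      DirectSum.of (HHEven k (Alg k)) t β, ?_⟩
    rw [of_mul_zetaOf]
    refine (congrArg _ hβ).trans ?_
    rw [map_add, map_sum]
    simp only [xiOf, ← DirectSum.lof_eq_of k, map_smul]
  | add a b ha hb =>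
    obtain ⟨s, hs, h, rfl⟩ := ha
    obtain ⟨s', hs', h', rfl⟩ := hb
    exact ⟨s + s', add_mem hs hs', h + h', by rw [add_mul]; abel⟩

/-! ### The symbol map to polynomials and its kernel -/

open Polynomial in
/-- The generating polynomial of the coefficients of a cohomology class. -/
noncomputable def coefPoly (t : ℕ) : HH k (Alg k) (2 * t) →ₗ[k] k[X] :=
  ∑ r : Fin (2 * t + 1), monomial (r : ℕ) ∘ₗ coef k t (r : ℕ)

open Polynomial in
/-- The symbol of an even cohomology class: the class `xi k t r` is sent to `X ^ r * Y ^ t`, and the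
multiples of `zeta k` are sent to zero. -/
noncomputable def symbol : HHEvenRing k (Alg k) →ₗ[k] k[X][X] :=
  DirectSum.toModule k ℕ _ fun t => (monomial t).restrictScalars k ∘ₗ coefPoly k t

open Polynomial

theorem symbol_of (t : ℕ) (α : HH k (Alg k) (2 * t)) :
    symbol k (DirectSum.of (HHEven k (Alg k)) t α) = monomial t (coefPoly k t α) := by
  rw [← DirectSum.lof_eq_of k, symbol, DirectSum.toModule_lof]
  rfl

theorem symbol_coeff (h : HHEvenRing k (Alg k)) (t : ℕ) :
    (symbol k h).coeff t = coefPoly k t (h t) := by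
  induction h using DirectSum.induction_on with
  | zero => simp
  | of s α =>
    rw [symbol_of, coeff_monomial]
    split_ifs with hst
    · subst hst
      rw [DirectSum.of_eq_same]
    · rw [DirectSum.of_eq_of_ne _ _ _ (Ne.symm hst), map_zero]
  | add a b ha hb => rw [map_add, coeff_add, ha, hb, DirectSum.add_apply, map_add]

theorem symbol_xiOf (t : ℕ) (r : Fin (2 * t + 1)) :
    symbol k (xiOf k t r) = monomial t (monomial (r : ℕ) 1) := by
  rw [xiOf, symbol_of, coefPoly, LinearMap.sum_apply, Fintype.sum_eq_single r]
  · simp [coef_xi]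
  · intro s hs
    simp [coef_xi, Fin.val_inj, hs]

theorem symbol_mul_zetaOf (h : HHEvenRing k (Alg k)) : symbol k (h * zetaOf k) = 0 := by
  induction h using DirectSum.induction_on with
  | zero => simp
  | of t α =>
    rw [of_mul_zetaOf, symbol_of, coefPoly, LinearMap.sum_apply]
    simp [coef_comp_zeta]
  | add a b ha hb => rw [add_mul, map_add, ha, hb, add_zero]

theorem symbol_one : symbol k 1 = 1 := by
  rw [one_eq_xiOf, symbol_xiOf]
  rfl

/-- By bilinearity it suffices to multiply two generators, where both indices and degrees add, as
exponents of monomials do. -/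
theorem symbol_mul_of_mem {a b : HHEvenRing k (Alg k)} (ha : a ∈ R k) (hb : b ∈ R k) :
    symbol k (a * b) = symbol k a * symbol k b := by
  rw [← Subalgebra.mem_toSubmodule, toSubmodule_R] at ha hb
  induction ha, hb using Submodule.span_induction₂ with
  | mem_mem a b ha hb =>
    obtain ⟨s, q, rfl⟩ := ha
    obtain ⟨t, r, rfl⟩ := hb
    simp only [xiOf_mul_xiOf, symbol_xiOf, monomial_mul_monomial, mul_one]
  | zero_left b hb => simp
  | zero_right a ha => simp
  | add_left a b c _ _ _ h₁ h₂ => rw [add_mul, map_add, map_add, h₁, h₂, add_mul]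
  | add_right a b c _ _ _ h₁ h₂ => rw [mul_add, map_add, map_add, h₁, h₂, mul_add]
  | smul_left c a b _ _ h => rw [smul_mul_assoc, map_smul, map_smul, h, smul_mul_assoc]
  | smul_right c a b _ _ h => rw [mul_smul_comm, map_smul, map_smul, h, mul_smul_comm]

theorem symbol_mul (hk : (2 : k) ≠ 0) (a b : HHEvenRing k (Alg k)) :
    symbol k (a * b) = symbol k a * symbol k b := by
  obtain ⟨s, hs, g, rfl⟩ := exists_eq_add_mul_zetaOf k hk a
  obtain ⟨t, ht, h, rfl⟩ := exists_eq_add_mul_zetaOf k hk b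
  -- Apart from the product of the two parts in R, every term is zero or, by centrality, a right
  -- multiple of `zetaOf`, which the symbol kills.
  rw [mul_add, add_mul, add_mul, mul_zetaOf_mul_mul_zetaOf, mul_assoc g, zetaOf_comm, ← mul_assoc,
    ← mul_assoc]
  simp only [map_add, symbol_mul_zetaOf, symbol_mul_of_mem k hs ht, add_zero]

/-- `symbol` as a homomorphism of algebras. -/
noncomputable def symbolHom (hk : (2 : k) ≠ 0) : HHEvenRing k (Alg k) →ₐ[k] k[X][X] :=
  AlgHom.ofLinearMap (symbol k) (symbol_one k) (symbol_mul k hk)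

theorem symbolHom_apply (hk : (2 : k) ≠ 0) (h : HHEvenRing k (Alg k)) :
    symbolHom k hk h = symbol k h := rfl

/-- A linear section of `symbol`. -/
noncomputable def ofSymbol : k[X][X] →ₗ[k] HHEvenRing k (Alg k) :=
  lsum fun t => lsum fun r => LinearMap.toSpanSingleton k _
    -- No class has a monomial X^r Y^t with r > 2t in its symbol; 0 is a default value there.
    (if h : r < 2 * t + 1 then xiOf k t ⟨r, h⟩ else 0)

/-- This left inverse gives injectivity of the symbol on R. -/
theorem ofSymbol_symbol {h : HHEvenRing k (Alg k)} (hh : h ∈ R k) :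
    ofSymbol k (symbol k h) = h := by
  rw [← Subalgebra.mem_toSubmodule, toSubmodule_R] at hh
  induction hh using Submodule.span_induction with
  | mem h hh =>
    obtain ⟨t, r, rfl⟩ := hh
    rw [symbol_xiOf]
    simp only [ofSymbol, lsum_apply, LinearMap.toSpanSingleton_apply]
    rw [sum_monomial_index, sum_monomial_index, one_smul, dif_pos r.2]
    · rw [zero_smul]
    · exact sum_zero_index _
  | zero => simp
  | add a b _ _ ha hb => rw [map_add, map_add, ha, hb]
  | smul c a _ ha => rw [map_smul, map_smul, ha]

theorem symbol_eq_zero_iff (hk : (2 : k) ≠ 0) (h : HHEvenRing k (Alg k)) :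
    symbol k h = 0 ↔ ∃ g, h = g * zetaOf k := by
  constructor
  · intro h0
    obtain ⟨s, hs, g, rfl⟩ := exists_eq_add_mul_zetaOf k hk h
    rw [map_add, symbol_mul_zetaOf, add_zero] at h0
    refine ⟨g, ?_⟩
    rw [← ofSymbol_symbol k hs, h0, map_zero, zero_add]
  · rintro ⟨g, rfl⟩
    exact symbol_mul_zetaOf k g

/-- The outer variable records the degree: its t-th coefficient in the symbol depends only on the
t-th component of the class. -/
theorem isHomogeneous_ker (hk : (2 : k) ≠ 0) :
    IsHomogeneous (TwoSidedIdeal.ker (symbolHom k hk)) := by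
  intro z hz t
  rw [TwoSidedIdeal.mem_ker, symbolHom_apply] at hz ⊢
  rw [symbol_of, ← symbol_coeff, hz, coeff_zero, monomial_zero_right]

/-- Kernel elements are multiples of the central, square-zero `zetaOf`, so any two of them multiply
to zero. -/
theorem isNilpotent_ker (hk : (2 : k) ≠ 0) :
    IsNilpotent (TwoSidedIdeal.ker (symbolHom k hk)).asIdeal := by
  refine ⟨2, ?_⟩
  rw [Submodule.pow_succ, Submodule.pow_one, Submodule.zero_eq_bot, eq_bot_iff, Ideal.mul_le]
  intro a ha b hb
  rw [TwoSidedIdeal.mem_asIdeal, TwoSidedIdeal.mem_ker, symbolHom_apply,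
    symbol_eq_zero_iff k hk] at ha hb
  obtain ⟨a, rfl⟩ := ha
  obtain ⟨b, rfl⟩ := hb
  exact mul_zetaOf_mul_mul_zetaOf k a b

end QCI

/-! ### The largest homogeneous nilpotent ideal and its quotient -/

theorem mainTheorem5 (k : Type u) [Field k] (hk : ringChar k ≠ 2) :
    ∃ N : TwoSidedIdeal (Hochschild.HHEvenRing k (QCI.Alg k)),
      IsGreatest (Hochschild.homogeneousNilpotentIdeals k (QCI.Alg k)) N ∧
        ∃ e : QCI.R k ≃ₐ[k] Hochschild.HHEvenRing k (QCI.Alg k) ⧸ N.asIdeal,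
          ∀ z : QCI.R k,
            e z = Ideal.Quotient.mk N.asIdeal (z : Hochschild.HHEvenRing k (QCI.Alg k)) := by
  have h2 : (2 : k) ≠ 0 := Ring.two_ne_zero hk
  let N := TwoSidedIdeal.ker (QCI.symbolHom k h2)
  have mem_N (z) : z ∈ N ↔ QCI.symbol k z = 0 := TwoSidedIdeal.mem_ker _
  refine ⟨N, ⟨⟨QCI.isHomogeneous_ker k h2, QCI.isNilpotent_ker k h2⟩, ?_⟩, ?_⟩
  · rintro I ⟨-, n, hn⟩ z hz
    refine (mem_N z).mpr ?_
    have h : z ^ n = 0 := by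
      have := Ideal.pow_mem_pow (TwoSidedIdeal.mem_asIdeal.mpr hz) n
      rwa [hn] at this
    -- The symbol of a nilpotent element is nilpotent in a polynomial ring over a field, hence zero.
    refine eq_zero_of_pow_eq_zero (n := n) ?_
    rw [← QCI.symbolHom_apply k h2, ← map_pow, h, map_zero]
  · let φ : QCI.R k →ₐ[k] Hochschild.HHEvenRing k (QCI.Alg k) ⧸ N.asIdeal :=
      (Ideal.Quotient.mkₐ k N.asIdeal).comp (QCI.R k).val
    refine ⟨AlgEquiv.ofBijective φ ⟨?_, ?_⟩, fun z => rfl⟩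
    · refine (injective_iff_map_eq_zero φ).mpr fun z hz => ?_
      have hz' : (z : Hochschild.HHEvenRing k (QCI.Alg k)) ∈ N :=
        TwoSidedIdeal.mem_asIdeal.mp (Ideal.Quotient.eq_zero_iff_mem.mp hz)
      rw [mem_N] at hz'
      refine Subtype.ext ?_
      rw [← QCI.ofSymbol_symbol k z.2, hz', map_zero]
      rfl
    · intro w
      obtain ⟨h, rfl⟩ := Ideal.Quotient.mk_surjective w
      obtain ⟨s, hs, g, rfl⟩ := QCI.exists_eq_add_mul_zetaOf k h2 h
      refine ⟨⟨s, hs⟩, Ideal.Quotient.eq.mpr ?_⟩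
      rw [TwoSidedIdeal.mem_asIdeal, mem_N, QCI.symbol_eq_zero_iff k h2]
      -- The lift s of the class of s + g·ζ differs from it by -g·ζ.
      exact ⟨-g, by simp⟩
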